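/- **Setting.** Let $\Upsilon=(0,\infty)$ with its Borel $\sigma$-algebra, $\Omega=\Upsilon^{\mathbb N}\times\Upsilon^{\mathbb N}\times\Upsilon$ with its Borel $\sigma$-algebra $\Sigma$, and let $W=(W_n)_{n\ge1}$, $X=(X_n)_{n\ge1}$ and $\Theta$ be the coordinate projections. Put $T_n=\sum_{k\le n}W_k$, $N_t=\sum_{n\ge0}n\,\chi_{\{T_n\le t<T_{n+1}\}}$, $S_t=\sum_{k=1}^{N_t}X_k$ and $\mathcal F_t=\sigma(\{S_u:u\le t\}\cup\{\Theta\})$ for $t\ge0$. Let $\mu,\rho$ be arbitrary Borel probability measures on $\Upsilon$, let $P_\theta=\mathrm{Exp}(\theta)^{\otimes\mathbb N}\otimes\mu^{\otimes\mathbb N}\otimes\delta_\theta$ for $\theta\in\Upsilon$ and $P=\int P_\theta\,\rho(d\theta)$. The image of a measure $Q$ under a random variable $Z$ is denoted $Q_Z$; thus $P_{X_1}=\mu$ and $P_\Theta=\rho$. **Definitions.** Let $Q,Q'$ be probability measures on $\Sigma$. * (a1): $W$ and $X$ are $Q$-conditionally independent given $\Theta$. (a2): $\Theta$ and $X$ are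 $Q$-independent. * $Q\overset{pr}{\sim}Q'$ (progressive equivalence): $Q$ and $Q'$ have the same null sets in $\mathcal F_t$, for every $t\ge0$. * $(N,X)$ is a $Q$-risk process if $N$ is a counting process under $Q$ (almost all paths start at $0$, are increasing, right-continuous and unbounded, with jumps of size at most one), $X$ is $Q$-i.i.d., and $N$ and $X$ are $Q$-independent. * For measurable $g:\Upsilon\to\Upsilon$, $S$ is a $Q$-CMPP$(g(\Theta),Q_{X_1})$ if $(N,X)$ is a $Q$-risk process, $N$ has conditionally stationary independent increments given $\Theta$ under $Q$, and for every $t>0$ the conditional law of $N_t$ given $\Theta$ is the Poisson law with parameter $t\,g(\Theta)$. For $r>0$, $S$ is a $Q$-CPP$(r,Q_{X_1})$ if $(N,X)$ is a $Q$-risk process and $N$ is a Poisson process with rate $r$ under $Q$. * $\mathfrak M_+(\Upsilon)$ is the set of measurable $g:\Upsilon\to\Upsilon$. For such $g$, $\mathcal M_{S,g}$ is the set of probability measures $Q$ with (a1), (a2), $Q\overset{pr}{\sim}P$ and $S$ a $Q$-CMPP$(g(\Theta),Q_{X_1})$. For $\theta\in\Upsilon$, $\widetilde{\mathcal M}_{S,g}(\theta)$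 is the set of probability measures $Q'$ with $Q'\overset{pr}{\sim}P_\theta$ and $S$ a $Q'$-CPP$(g(\theta),Q'_{X_1})$. * $\mathcal F_P$ is the set of measurable $\beta:\Upsilon\times\Upsilon\to\mathbb R$ of the form $\beta(x,\theta)=\alpha(\theta)+\gamma(x)$ with measurable $\alpha,\gamma:\Upsilon\to\mathbb R$ and $\mathbb E_P[e^{\gamma(X_1)}]=1$ (then $\alpha,\gamma$ are determined by $\beta$). $\mathcal R_+(\Upsilon)$ is the set of measurable $\xi:\Upsilon\to\mathbb R$ with $P_\Theta(\{\xi>0\})=1$ and $\mathbb E_P[\xi(\Theta)]=1$. * For $\beta\in\mathcal F_P$, $\xi\in\mathcal R_+(\Upsilon)$: $\widetilde M^{(\beta)}_t(\theta)=\exp\bigl(\sum_{k=1}^{N_t}\beta(X_k,\theta)-t\theta(e^{\alpha(\theta)}-1)\bigr)$ and $M^{(\beta)}_t(\Theta)=\xi(\Theta)\,\widetilde M^{(\beta)}_t(\Theta)$. * A regular conditional probability (r.c.p.) of $Q$ over $Q_\Theta$ consistent with $\Theta$ is a family $(Q_\theta)_{\theta\in\Upsilon}$ of probability measures on $\Sigma$,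 with $\theta\mapsto Q_\theta(D)$ measurable and $\int Q_\theta(D)\,Q_\Theta(d\theta)=Q(D)$ for all $D\in\Sigma$, such that for each Borel $B$, $Q_\theta(\Theta^{-1}(B))=1$ for $Q_\Theta$-almost all $\theta\in B$. For $g\in\mathfrak M_+(\Upsilon)$, $Q\in\mathcal M_{S,g}$, $\beta\in\mathcal F_P$ and $\xi\in\mathcal R_+(\Upsilon)$ consider the conditions * $(**)$ $g(\Theta)=\Theta e^{\alpha(\Theta)}$ on $\Omega$, and $\gamma=\ln f$ $P_{X_1}$-a.s. for a $P_{X_1}$-a.s. positive Radon–Nikodým derivative $f$ of $Q_{X_1}$ with respect to $P_{X_1}$; * $(M_\xi)$ $Q(A)=\int_A M^{(\beta)}_t(\Theta)\,dP$ for all $0\le s\le t$ and $A\in\mathcal F_s$; * $(M_\theta)$ $Q_\theta(A)=\int_A \widetilde M^{(\beta)}_t(\theta)\,dP_\theta$ for all $0\le s\le t$ and $A\in\mathcal F_s$. **Theorem 4.3.** (i) For each $g\in\mathfrak M_+(\Upsilon)$ and $Q\in\mathcal M_{S,g}$ there is a pair $(\beta,\xi)\in\mathcal F_P\times\mathcal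 R_+(\Upsilon)$, with $\xi$ a Radon–Nikodým derivative of $Q_\Theta$ with respect to $P_\Theta$, satisfying $(**)$ and $(M_\xi)$ and such that $(M^{(\beta)}_t(\Theta))_{t\ge0}$ is an $(\mathcal F_t)$-martingale in $\mathcal L^1(P)$. It is essentially unique: any other pair in $\mathcal F_P\times\mathcal R_+(\Upsilon)$ with $(**)$, $(M_\xi)$ and the martingale property agrees with it, in the first component $P_{X_1}\otimes P_\Theta$-a.e. and in the second $P_\Theta$-a.e. (ii) Conversely, for every $(\beta,\xi)\in\mathcal F_P\times\mathcal R_+(\Upsilon)$ there is a unique pair $(g,Q)$ with $g\in\mathfrak M_+(\Upsilon)$ and $Q\in\mathcal M_{S,g}$ satisfying $(**)$ and $(M_\xi)$ and such that $(M^{(\beta)}_t(\Theta))_{t\ge0}$ is an $(\mathcal F_t)$-martingale in $\mathcal L^1(P)$; moreover $\xi$ is then a Radon–Nikodým derivative of $Q_\Theta$ with respect to $P_\Theta$. (iii) For all $(g,Q)$ and $(\beta,\xi)$ related as in (i) or (ii), there is an r.c.p. $(Q_\theta)_{\theta\in\Upsilon}$ of $Q$ over $Q_\Theta$ consistent with $\Theta$,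 unique up to a $P_\Theta$-null set of $\theta$, and a $P_\Theta$-null Borel set $V_*\subseteq\Upsilon$ such that for every $\theta\notin V_*$: $Q_\theta\in\widetilde{\mathcal M}_{S,g}(\theta)$, $(M_\theta)$ holds, and $(\widetilde M^{(\beta)}_t(\theta))_{t\ge0}$ is an $(\mathcal F_t)$-martingale in $\mathcal L^1(P_\theta)$. -/

import Mathlib

open MeasureTheory ProbabilityTheory Set Filter
open scoped NNReal ENNReal

noncomputable section

namespace CMPP

/-! ### The canonical space -/

/-- The state space `(0, ∞)` with its Borel sigma-algebra. -/
abbrev Pos : Type := Set.Ioi (0 : ℝ)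

instance : StandardBorelSpace Pos := measurableSet_Ioi.standardBorel

instance : Nonempty Pos := ⟨⟨1, Set.mem_Ioi.2 one_pos⟩⟩

/-- The canonical space `(0,∞)^ℕ × (0,∞)^ℕ × (0,∞)` with its product (= Borel) sigma-algebra:
interarrival times, claim sizes and structure parameter. -/
abbrev Omega : Type := ((ℕ → Pos) × (ℕ → Pos)) × Pos

/-- `W n` is the interarrival time with (one-based) number `n + 1`. -/
def W (n : ℕ) (ω : Omega) : Pos := ω.1.1 n

/-- `X n` is the claim size with (one-based) number `n + 1`; the first claim size is `X 0`. -/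
def X (n : ℕ) (ω : Omega) : Pos := ω.1.2 n

/-- The structure parameter, i.e. the canonical projection onto the last factor. -/
def Θ (ω : Omega) : Pos := ω.2

/-- The arrival times `T_0 = 0`, `T_n = W_1 + ... + W_n`. -/
def T (n : ℕ) (ω : Omega) : ℝ := ∑ k ∈ Finset.range n, (W k ω : ℝ)

/-- The counting process `N_t = #{n ≥ 1 : T_n ≤ t}`. On the event that infinitely many arrivals
occur up to time `t` the value is `0`, exactly as in `N_t = ∑_n n 1{T_n ≤ t < T_{n+1}}`
(all terms of that series then vanish). -/
def N (t : ℝ≥0) (ω : Omega) : ℕ := {n : ℕ | T (n + 1) ω ≤ t}.ncard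

/-- The aggregate process `S_t = X_1 + ... + X_{N_t}`. -/
def S (t : ℝ≥0) (ω : Omega) : ℝ := ∑ k ∈ Finset.range (N t ω), (X k ω : ℝ)

lemma measurable_W (n : ℕ) : Measurable (W n) := by unfold W; fun_prop

lemma measurable_X (n : ℕ) : Measurable (X n) := by unfold X; fun_prop

lemma measurable_Θ : Measurable Θ := measurable_snd

lemma measurable_T (n : ℕ) : Measurable (T n) := by
  unfold T
  exact Finset.measurable_fun_sum _ fun k _ => measurable_subtype_coe.comp (measurable_W k)

lemma strictMono_T (ω : Omega) : StrictMono fun n => T n ω := by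
  refine strictMono_nat_of_lt_succ fun n => ?_
  simp only [T, Finset.sum_range_succ]
  exact lt_add_of_pos_right _ (W n ω).2

lemma N_eq_succ_iff (t : ℝ≥0) (ω : Omega) (n : ℕ) :
    N t ω = n + 1 ↔ T (n + 1) ω ≤ t ∧ (t : ℝ) < T (n + 2) ω := by
  have hm := (strictMono_T ω).monotone
  have key : ∀ n : ℕ, T (n + 1) ω ≤ t → (t : ℝ) < T (n + 2) ω → N t ω = n + 1 := by
    intro n h1 h2
    have : {k : ℕ | T (k + 1) ω ≤ t} = ↑(Finset.range (n + 1)) := by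
      ext k
      simp only [Set.mem_ofPred_eq, Finset.coe_range, Set.mem_Iio]
      constructor
      · intro hk
        by_contra hc
        exact absurd (h2.trans_le ((hm (show n + 2 ≤ k + 1 by omega)).trans hk)) (lt_irrefl _)
      · intro hk
        exact (hm (show k + 1 ≤ n + 1 by omega)).trans h1
    rw [N, this, Set.ncard_coe_finset, Finset.card_range]
  refine ⟨fun h => ?_, fun h => key n h.1 h.2⟩
  have hfin : {k : ℕ | T (k + 1) ω ≤ t}.Finite := by
    by_contra hc
    rw [N, Set.Infinite.ncard hc] at h
    omega
  have hne : {k : ℕ | T (k + 1) ω ≤ t}.Nonempty := by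
    by_contra hc
    rw [Set.not_nonempty_iff_eq_empty] at hc
    rw [N, hc, Set.ncard_empty] at h
    omega
  obtain ⟨m, hm1, hm2⟩ := hfin.exists_maximalFor id _ hne
  have h3 : (t : ℝ) < T (m + 2) ω := by
    by_contra hc
    have := hm2 (j := m + 1) (not_lt.1 hc) (by simp)
    simp at this
  have h4 := key m hm1 h3
  have : m = n := by omega
  subst this
  exact ⟨hm1, h3⟩

lemma measurable_N (t : ℝ≥0) : Measurable (N t) := by
  have hs : ∀ n : ℕ, MeasurableSet (N t ⁻¹' {n + 1}) := by
    intro n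
    have : N t ⁻¹' {n + 1} = {ω | T (n + 1) ω ≤ t} ∩ {ω | (t : ℝ) < T (n + 2) ω} := by
      ext ω
      exact N_eq_succ_iff t ω n
    rw [this]
    exact (measurableSet_le (measurable_T _) measurable_const).inter
      (measurableSet_lt measurable_const (measurable_T _))
  refine measurable_to_countable' fun n => ?_
  cases n with
  | succ n => exact hs n
  | zero =>
    have : N t ⁻¹' {0} = (⋃ n : ℕ, N t ⁻¹' {n + 1})ᶜ := by
      ext ω
      simp only [Set.mem_preimage, Set.mem_singleton_iff, Set.mem_compl_iff, Set.mem_iUnion]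
      constructor
      · rintro h ⟨n, hn⟩
        omega
      · intro h
        by_contra hc
        exact h ⟨N t ω - 1, by omega⟩
    rw [this]
    exact (MeasurableSet.iUnion hs).compl

lemma measurable_S (t : ℝ≥0) : Measurable (S t) := by
  have : Measurable fun p : ℕ × Omega => ∑ k ∈ Finset.range p.1, (X k p.2 : ℝ) :=
    measurable_from_prod_countable_right fun n => by
      change Measurable fun ω => ∑ k ∈ Finset.range n, (X k ω : ℝ)
      exact Finset.measurable_fun_sum _ fun k _ => measurable_subtype_coe.comp (measurable_X k)
  exact this.comp ((measurable_N t).prodMk measurable_id)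

/-- The sigma-algebra generated by the structure parameter. -/
abbrev sigmaΘ : MeasurableSpace Omega := MeasurableSpace.comap Θ Subtype.instMeasurableSpace

lemma sigmaΘ_le : sigmaΘ ≤ Prod.instMeasurableSpace := measurable_Θ.comap_le

/-- The filtration `F_t = σ({S_u : u ≤ t} ∪ {Θ})`. -/
def F : Filtration ℝ≥0 (Prod.instMeasurableSpace : MeasurableSpace Omega) where
  seq t := (⨆ (u : ℝ≥0) (_ : u ≤ t), MeasurableSpace.comap (S u) Real.measurableSpace) ⊔ sigmaΘ
  mono' s t h := by
    refine sup_le_sup_right (iSup₂_le fun u hu => ?_) _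
    exact le_iSup₂ (f := fun (u : ℝ≥0) (_ : u ≤ t) =>
      MeasurableSpace.comap (S u) Real.measurableSpace) u (hu.trans h)
  le' _ := by
    refine sup_le ?_ ?_
    · exact iSup₂_le fun u _ => measurable_iff_comap_le.1 (measurable_S u)
    · exact sigmaΘ_le

/-! ### The initial probability measure and its disintegration -/

/-- The exponential distribution with rate `θ`, as a measure on `(0, ∞)`. -/
def expPos (θ : Pos) : Measure Pos := (expMeasure (θ : ℝ)).comap Subtype.val

lemma expPos_apply (θ : Pos) {D : Set Pos} (hD : MeasurableSet D) :
    expPos θ D = ∫⁻ x in Subtype.val '' D, exponentialPDF (θ : ℝ) x := by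
  have hD' : MeasurableSet (Subtype.val '' D : Set ℝ) := measurableSet_Ioi.subtype_image hD
  rw [expPos, Measure.comap_apply _ Subtype.val_injective
    (fun s hs => measurableSet_Ioi.subtype_image hs) _ hD, expMeasure, gammaMeasure,
    withDensity_apply _ hD']
  rfl

instance (θ : Pos) : IsProbabilityMeasure (expPos θ) := by
  refine ⟨?_⟩
  rw [expPos_apply θ MeasurableSet.univ, Set.image_univ, Subtype.range_val,
    setLIntegral_congr Ioi_ae_eq_Ici]
  have h := lintegral_exponentialPDF_eq_one (r := (θ : ℝ)) θ.2
  rw [← lintegral_add_compl _ (measurableSet_Ici (a := (0 : ℝ))), Set.compl_Ici,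
    lintegral_exponentialPDF_of_nonpos le_rfl, add_zero] at h
  exact h

lemma measurable_expPos : Measurable expPos := by
  refine Measure.measurable_of_measurable_coe _ fun D hD => ?_
  simp_rw [expPos_apply _ hD]
  refine Measurable.lintegral_prod_right' (f := fun p : Pos × ℝ => exponentialPDF (p.1 : ℝ) p.2) ?_
  simp_rw [exponentialPDF_eq]
  refine ENNReal.measurable_ofReal.comp (Measurable.ite ?_ ?_ measurable_const)
  · exact measurableSet_le measurable_const measurable_snd
  · fun_prop

lemma measurable_infinitePi_expPos :
    Measurable fun θ : Pos => Measure.infinitePi fun _ : ℕ => expPos θ := by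
  refine Measurable.measure_of_isPiSystem_of_isProbabilityMeasure
    (generateFrom_squareCylinders (α := fun _ : ℕ => Pos)).symm
    (isPiSystem_squareCylinders (fun _ => MeasurableSpace.isPiSystem_measurableSet) (by simp)) ?_
  rintro s ⟨I, B, hB, rfl⟩
  have hB' : ∀ n, MeasurableSet (B n) := fun n => hB n (Set.mem_univ n)
  simp_rw [Measure.infinitePi_pi (s := I) _ fun n _ => hB' n]
  exact Finset.measurable_fun_prod _ fun n _ => (Measure.measurable_coe (hB' n)).comp measurable_expPos

/-- The family of fibre measures `P_θ = Exp(θ)^{⊗ℕ} ⊗ μ^{⊗ℕ} ⊗ δ_θ`, which depends measurably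
on `θ`. -/
def fibre (μ : Measure Pos) [IsProbabilityMeasure μ] : Kernel Pos Omega where
  toFun θ := ((Measure.infinitePi fun _ : ℕ => expPos θ).prod
    (Measure.infinitePi fun _ : ℕ => μ)).prod (Measure.dirac θ)
  measurable' := by
    let κ : Kernel Pos (ℕ → Pos) := ⟨_, measurable_infinitePi_expPos⟩
    have : IsMarkovKernel κ := ⟨fun θ => by
      change IsProbabilityMeasure (Measure.infinitePi fun _ : ℕ => expPos θ)
      infer_instance⟩
    let η := (κ ×ₖ Kernel.const Pos (Measure.infinitePi fun _ : ℕ => μ)) ×ₖ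
      Kernel.deterministic (id : Pos → Pos) measurable_id
    have h : ∀ θ, η θ = ((Measure.infinitePi fun _ : ℕ => expPos θ).prod
        (Measure.infinitePi fun _ : ℕ => μ)).prod (Measure.dirac θ) := fun θ => by
      simp only [η, Kernel.prod_apply, Kernel.const_apply, Kernel.deterministic_apply, id]
      rfl
    exact (funext h : (η : Pos → Measure Omega) = _) ▸ η.measurable

instance (μ : Measure Pos) [IsProbabilityMeasure μ] : IsMarkovKernel (fibre μ) :=
  ⟨fun θ => by
    change IsProbabilityMeasure (((Measure.infinitePi fun _ : ℕ => expPos θ).prod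
      (Measure.infinitePi fun _ : ℕ => μ)).prod (Measure.dirac θ))
    infer_instance⟩

/-- The initial probability measure `P = ∫ P_θ ρ(dθ)`. -/
def initial (μ ρ : Measure Pos) [IsProbabilityMeasure μ] : Measure Omega := ρ.bind (fibre μ)

instance (μ ρ : Measure Pos) [IsProbabilityMeasure μ] [IsProbabilityMeasure ρ] :
    IsProbabilityMeasure (initial μ ρ) := by unfold initial; infer_instance

/-! ### Risk processes, (mixed) Poisson processes, compound (mixed) Poisson processes -/

/-- `N` is a counting process under `Q`: almost all paths start at zero, are increasing and
right-continuous, jump upwards by at most one and are unbounded. -/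
def IsCountingProcess (Q : Measure Omega) : Prop :=
  ∀ᵐ ω ∂Q, N 0 ω = 0 ∧ Monotone (fun t => N t ω) ∧
    (∀ t, ContinuousWithinAt (fun s => N s ω) (Set.Ioi t) t) ∧
    (∀ t, 0 < t → ∃ s < t, N t ω ≤ N s ω + 1) ∧
    ∀ n : ℕ, ∃ t, n ≤ N t ω

/-- `(N, X)` is a risk process under `Q`: `N` is a counting process, the (positive) claim sizes
are i.i.d., and the processes `N` and `X` are independent. -/
structure IsRiskProcess (Q : Measure Omega) : Prop where
  counting : IsCountingProcess Q
  indep : iIndepFun X Q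
  identDistrib : ∀ n, Q.map (X n) = Q.map (X 0)
  indep_N_X : IndepFun (fun ω t => N t ω) (fun ω n => X n ω) Q

/-- The vector of the increments of `N` along the time points `h + t_0, ..., h + t_n`. -/
def incr {n : ℕ} (t : Fin (n + 1) → ℝ≥0) (h : ℝ≥0) (ω : Omega) (i : Fin n) : ℤ :=
  (N (h + t i.succ) ω : ℤ) - N (h + t i.castSucc) ω

/-- `N` is a Poisson process with rate `r` under `Q`: independent and stationary increments,
and `N_t` has the Poisson distribution with parameter `t r`. -/
structure IsPoissonProcess (Q : Measure Omega) (r : Pos) : Prop where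
  indep : ∀ (n : ℕ) (t : Fin (n + 1) → ℝ≥0), Monotone t →
    iIndepFun (fun (i : Fin n) ω => incr t 0 ω i) Q
  stationary : ∀ (n : ℕ) (t : Fin (n + 1) → ℝ≥0), Monotone t → ∀ h : ℝ≥0,
    Q.map (incr t h) = Q.map (incr t 0)
  poisson : ∀ t : ℝ≥0, 0 < t → Q.map (N t) = poissonMeasure (t * (r : ℝ).toNNReal)

/-- `N` is a mixed Poisson process with parameter `g(Θ)` under `Q`: conditionally on `Θ` it has
independent and stationary increments, and the conditional distribution of `N_t` given `Θ` is the
Poisson distribution with parameter `t g(Θ)`. -/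
structure IsMixedPoissonProcess (Q : Measure Omega) [IsFiniteMeasure Q] (g : Pos → Pos) :
    Prop where
  indep : ∀ (n : ℕ) (t : Fin (n + 1) → ℝ≥0), Monotone t →
    iCondIndepFun sigmaΘ sigmaΘ_le (fun (i : Fin n) ω => incr t 0 ω i) Q
  stationary : ∀ (n : ℕ) (t : Fin (n + 1) → ℝ≥0), Monotone t → ∀ h : ℝ≥0,
    ∀ᵐ θ ∂(Q.map Θ), condDistrib (incr t h) Θ Q θ = condDistrib (incr t 0) Θ Q θ
  poisson : ∀ t : ℝ≥0, 0 < t →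
    ∀ᵐ θ ∂(Q.map Θ), condDistrib (N t) Θ Q θ = poissonMeasure (t * (g θ : ℝ).toNNReal)

/-- `S` is a compound mixed Poisson process with parameters `g(Θ)` and `Q_{X_1}` under `Q`. -/
def IsCMPP (Q : Measure Omega) [IsFiniteMeasure Q] (g : Pos → Pos) : Prop :=
  IsRiskProcess Q ∧ IsMixedPoissonProcess Q g

/-- `S` is a compound Poisson process with parameters `r` and `Q_{X_1}` under `Q`. -/
def IsCPP (Q : Measure Omega) (r : Pos) : Prop :=
  IsRiskProcess Q ∧ IsPoissonProcess Q r

/-- Condition (a1): the processes `W` and `X` are conditionally independent given `Θ`. -/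
def CondA1 (Q : Measure Omega) [IsFiniteMeasure Q] : Prop :=
  CondIndepFun sigmaΘ sigmaΘ_le (fun ω n => W n ω) (fun ω n => X n ω) Q

/-- Condition (a2): `Θ` and the process `X` are independent. -/
def CondA2 (Q : Measure Omega) : Prop :=
  IndepFun Θ (fun ω n => X n ω) Q

/-- `Q` and `P` are progressively equivalent: they have the same null sets in every `F_t`. -/
def ProgEquiv (Q P : Measure Omega) : Prop :=
  ∀ (t : ℝ≥0) (A : Set Omega), MeasurableSet[F t] A → (Q A = 0 ↔ P A = 0)

/-- `Q` belongs to the class `M_{S,g}` (relative to `P`). -/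
structure MemM (P : Measure Omega) (g : Pos → Pos) (Q : Measure Omega) [IsFiniteMeasure Q] :
    Prop where
  a1 : CondA1 Q
  a2 : CondA2 Q
  progEquiv : ProgEquiv Q P
  cmpp : IsCMPP Q g

/-- `Q'` belongs to the fibrewise class at `θ` (relative to the fibre measure `P' = P_θ`):
it is progressively equivalent to `P'` and `S` is a compound Poisson process with rate `g(θ)`. -/
def MemMFibre (P' : Measure Omega) (g : Pos → Pos) (θ : Pos) (Q' : Measure Omega) : Prop :=
  ProgEquiv Q' P' ∧ IsCPP Q' (g θ)

/-- `κ` is a regular conditional probability of `Q` over `Q_Θ` consistent with `Θ`. -/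
structure IsRCP (κ : Kernel Pos Omega) (Q : Measure Omega) : Prop where
  isMarkovKernel : IsMarkovKernel κ
  lintegral_eq : ∀ D, MeasurableSet D → ∫⁻ θ, κ θ D ∂(Q.map Θ) = Q D
  consistent : ∀ B, MeasurableSet B → ∀ᵐ θ ∂(Q.map Θ), θ ∈ B → κ θ (Θ ⁻¹' B) = 1

/-! ### The parameters `(β, ξ)` and the density processes -/

/-- `β(x, θ) = α(θ) + γ(x)` with measurable real functions `α`, `γ` and `E_P[exp γ(X_1)] = 1`.
The normalization makes `α` and `γ` unique for given `β`. -/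
structure IsSplit (P : Measure Omega) (β : Pos → Pos → ℝ) (α γ : Pos → ℝ) : Prop where
  measurable_α : Measurable α
  measurable_γ : Measurable γ
  eq_add : ∀ x θ, β x θ = α θ + γ x
  integral_exp : ∫ ω, Real.exp (γ (X 0 ω)) ∂P = 1

/-- The class `F_P`. -/
def FP (P : Measure Omega) : Set (Pos → Pos → ℝ) :=
  {β | Measurable (Function.uncurry β) ∧ ∃ α γ, IsSplit P β α γ}

/-- The class `R_+((0,∞))`. -/
def RPlus (P : Measure Omega) : Set (Pos → ℝ) :=
  {ξ | Measurable ξ ∧ (∀ᵐ θ ∂(P.map Θ), 0 < ξ θ) ∧ ∫ ω, ξ (Θ ω) ∂P = 1}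

/-- `f` is a (real-valued) Radon-Nikodym derivative of `ν'` with respect to `ν`. -/
def IsRNDeriv (f : Pos → ℝ) (ν' ν : Measure Pos) : Prop :=
  Measurable f ∧ (∀ᵐ x ∂ν, 0 ≤ f x) ∧ ν' = ν.withDensity fun x => ENNReal.ofReal (f x)

/-- The fibrewise density process
`exp (∑_{k ≤ N_t} β(X_k, θ) - t θ (e^{α(θ)} - 1))`. -/
def MTilde (β : Pos → Pos → ℝ) (α : Pos → ℝ) (θ : Pos) (t : ℝ≥0) (ω : Omega) : ℝ :=
  Real.exp ((∑ k ∈ Finset.range (N t ω), β (X k ω) θ) - t * θ * (Real.exp (α θ) - 1))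

/-- The density process `ξ(Θ) exp (∑_{k ≤ N_t} β(X_k, Θ) - t Θ (e^{α(Θ)} - 1))`. -/
def MProc (β : Pos → Pos → ℝ) (α ξ : Pos → ℝ) (t : ℝ≥0) (ω : Omega) : ℝ :=
  ξ (Θ ω) * MTilde β α (Θ ω) t ω

/-- `Z` is a density process of `Q` with respect to `P`:
`Q(A) = ∫_A Z_t dP` for all `s ≤ t` and `A ∈ F_s`. -/
def IsDensityProcess (Q P : Measure Omega) (Z : ℝ≥0 → Omega → ℝ) : Prop :=
  ∀ s t : ℝ≥0, s ≤ t → ∀ A, MeasurableSet[F s] A → Q.real A = ∫ ω in A, Z t ω ∂P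

/-- The relation between `(g, Q)` and `(β, ξ)`, where `β(x, θ) = α(θ) + γ(x)`:
`g(θ) = θ e^{α(θ)}`, `γ = ln f` for an a.s. positive Radon-Nikodym derivative `f` of `Q_{X_1}`
with respect to `P_{X_1}`, and the martingale `MProc β α ξ` is a density process of `Q` with
respect to `P`. -/
structure Corresponds (P : Measure Omega) (g : Pos → Pos) (Q : Measure Omega)
    (β : Pos → Pos → ℝ) (ξ α γ : Pos → ℝ) : Prop where
  split : IsSplit P β α γ
  g_eq : ∀ ω, (g (Θ ω) : ℝ) = Θ ω * Real.exp (α (Θ ω))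
  γ_eq : ∃ f : Pos → ℝ, IsRNDeriv f (Q.map (X 0)) (P.map (X 0)) ∧
    ∀ᵐ x ∂(P.map (X 0)), 0 < f x ∧ γ x = Real.log (f x)
  density : IsDensityProcess Q P (MProc β α ξ)
  martingale : Martingale (MProc β α ξ) F P

end CMPP

end

open CMPP

noncomputable section

namespace CMPP

/-! ### Sequences and infinite products of one measure -/

/-! Everything reduces to one computation for compound Poisson laws with a frozen parameter. For `Q`
in `MemM P g` the structure is rigid: with `ν` the law of the first claim, `Q` must be the mixture
over `Q.map Θ` of the laws `cpp (g θ) ν θ`, under which interarrival times are i.i.d. exponential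
with rate `g θ`, claims are i.i.d. with law `ν` and independent of them, and `Θ = θ`.

Rigidity is `eq_of_isCMPP`. By (a1) and (a2) the claims factor out of every rectangle
(`measure_rectangle`); the conditional laws of the increments fix the joint law of `Θ` and the path
of `N`; and a non-explosive path of `N` determines the interarrival times. That the explicit mixture
belongs to the class rests on the renewal process with exponential interarrival times being Poisson,
which follows from restarting it at a deterministic time (`iid_expPos_slot_restartAt`).

For the densities, cut an event of `F t` according to the number `m` of arrivals up to `t`. On each
piece the event depends only on `Θ`, the first `m` interarrival times and the first `m` claims.
Passing from rate `θ` to rate `r` multiplies the arrival law by `(r / θ) ^ m * exp (-(r - θ) * t)`,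
and changing the claim law multiplies by the product of `m` values of its density. With `r = θ * exp
(α θ)` and claim density `exp γ` this is exactly `MTilde` (`cpp_apply_eq_lintegral`); integrating
with weight `ξ` gives `MProc` (`isDensityFamily_mixture`). An adapted, a.s. positive family of
densities yields the martingale property and progressive equivalence at once. Adaptedness needs an
argument, because `F t` is generated by `S` and not by `N` and `X`: the claims are read off as
increments of `S` along fine grids.

The correspondence is then bookkeeping: `g` determines `α`, the claim law determines `γ`, the law of
`Θ` determines `ξ`, and conversely. In (i) the positive Radon-Nikodym derivatives come from
progressive equivalence at time `0` (for `Θ`) and time `1` (for the claims). In (iii) the kernel is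
explicit, so the fibrewise statements hold for every `θ`. -/

/-- Prepend an element to a sequence. -/
def consSeq {α : Type*} (a : α) (w : ℕ → α) : ℕ → α
  | 0 => a
  | n + 1 => w n

@[simp] lemma consSeq_zero {α : Type*} (a : α) (w : ℕ → α) : consSeq a w 0 = a := rfl

@[simp] lemma consSeq_succ {α : Type*} (a : α) (w : ℕ → α) (n : ℕ) :
    consSeq a w (n + 1) = w n := rfl

lemma measurable_consSeq {α : Type*} [MeasurableSpace α] :
    Measurable fun p : α × (ℕ → α) => consSeq p.1 p.2 := by
  refine measurable_pi_lambda _ fun n => ?_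
  cases n with
  | zero => exact measurable_fst
  | succ n => exact (measurable_pi_apply n).comp measurable_snd

lemma measurable_consSeq_right {α : Type*} [MeasurableSpace α] (a : α) :
    Measurable fun w : ℕ → α => consSeq a w :=
  measurable_consSeq.comp (measurable_const.prodMk measurable_id)

/-- The law of an i.i.d. sequence. -/
abbrev iid {α : Type*} [MeasurableSpace α] (ν : Measure α) [IsProbabilityMeasure ν] :
    Measure (ℕ → α) :=
  Measure.infinitePi fun _ : ℕ => ν

/-- This is the engine of all later inductions on the number of arrivals or coordinates: it permits
integrating out the first coordinate and applying the induction hypothesis to the shifted sequence.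
-/
lemma map_consSeq_iid {α : Type*} [MeasurableSpace α] (ν : Measure α) [IsProbabilityMeasure ν] :
    (ν.prod (iid ν)).map (fun p : α × (ℕ → α) => consSeq p.1 p.2) = iid ν := by
  classical
  refine Measure.eq_infinitePi _ fun s t ht => ?_
  have hms : MeasurableSet (Set.pi (s : Set ℕ) t) :=
    MeasurableSet.pi s.countable_toSet fun i _ => ht i
  rw [Measure.map_apply measurable_consSeq hms]
  -- The constraints on coordinates `≥ 1`, shifted down by one; the possible constraint on
  -- coordinate `0` falls on the prepended element.
  let s' : Finset ℕ := s.preimage Nat.succ (Nat.succ_injective.injOn)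
  have hpre : (fun p : α × (ℕ → α) => consSeq p.1 p.2) ⁻¹' (Set.pi (s : Set ℕ) t)
      = (if 0 ∈ s then t 0 else univ) ×ˢ Set.pi (s' : Set ℕ) (fun i => t (i + 1)) := by
    ext ⟨a, w⟩
    simp only [mem_preimage, Set.mem_pi, Finset.mem_coe, mem_prod, s', Finset.mem_preimage]
    constructor
    · intro h
      refine ⟨?_, fun i hi => h (i + 1) hi⟩
      split_ifs with h0
      · exact h 0 h0
      · trivial
    · rintro ⟨h0, h1⟩ i hi
      cases i with
      | zero => simpa [hi] using h0
      | succ i => exact h1 i hi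
  rw [hpre, Measure.prod_prod, Measure.infinitePi_pi _ (fun i _ => ht (i + 1))]
  have h2 : ∏ i ∈ s', ν (t (i + 1)) = ∏ i ∈ s.erase 0, ν (t i) := by
    refine Finset.prod_bij' (fun i _ => i + 1) (fun i _ => i - 1) ?_ ?_ ?_ ?_ ?_
    · intro i hi
      simp only [s', Finset.mem_preimage] at hi
      simpa using hi
    · intro i hi
      have := Finset.mem_erase.1 hi
      simp only [s', Finset.mem_preimage, Nat.succ_eq_add_one]
      rw [Nat.sub_add_cancel (Nat.pos_of_ne_zero this.1)]
      exact this.2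
    · intro i hi; simp
    · intro i hi
      have := Finset.mem_erase.1 hi
      exact Nat.sub_add_cancel (Nat.pos_of_ne_zero this.1)
    · intro i hi; rfl
  rw [h2]
  split_ifs with h0
  · exact Finset.mul_prod_erase s (fun i => ν (t i)) h0
  · rw [measure_univ, one_mul, Finset.erase_eq_of_notMem h0]

lemma lintegral_iid_consSeq {α : Type*} [MeasurableSpace α] (ν : Measure α)
    [IsProbabilityMeasure ν] {F : (ℕ → α) → ℝ≥0∞} (hF : Measurable F) :
    ∫⁻ w, F w ∂(iid ν) = ∫⁻ a, ∫⁻ w, F (consSeq a w) ∂(iid ν) ∂ν := by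
  conv_lhs => rw [← map_consSeq_iid ν]
  rw [lintegral_map hF measurable_consSeq,
    lintegral_prod (fun p : α × (ℕ → α) => F (consSeq p.1 p.2))
      (hF.comp measurable_consSeq).aemeasurable]

lemma iid_apply_consSeq {α : Type*} [MeasurableSpace α] (ν : Measure α)
    [IsProbabilityMeasure ν] {B : Set (ℕ → α)} (hB : MeasurableSet B) :
    iid ν B = ∫⁻ a, iid ν (consSeq a ⁻¹' B) ∂ν := by
  conv_lhs => rw [← map_consSeq_iid ν]
  rw [Measure.map_apply measurable_consSeq hB,
    Measure.prod_apply (measurable_consSeq hB)]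
  rfl

lemma measurable_iid_consSeq {α : Type*} [MeasurableSpace α] (ν : Measure α)
    [IsProbabilityMeasure ν] {B : Set (ℕ → α)} (hB : MeasurableSet B) :
    Measurable fun a => iid ν (consSeq a ⁻¹' B) :=
  measurable_measure_prodMk_left (measurable_consSeq hB)

lemma lintegral_of_eq_withDensity {α : Type*} [MeasurableSpace α] {μ ν : Measure α}
    {f g : α → ℝ≥0∞} (hf : Measurable f) (hν : ν = μ.withDensity f) (hg : Measurable g) :
    ∫⁻ a, g a ∂ν = ∫⁻ a, f a * g a ∂μ := by
  rw [hν, lintegral_withDensity_eq_lintegral_mul _ hf hg]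
  rfl

/-- Change of measure for a set depending only on the first `m` coordinates. -/
lemma iid_withDensity_apply {α : Type*} [MeasurableSpace α] (μ ν : Measure α)
    [IsProbabilityMeasure μ] [IsProbabilityMeasure ν] {f : α → ℝ≥0∞} (hf : Measurable f)
    (hν : ν = μ.withDensity f) (m : ℕ) :
    ∀ D : Set (ℕ → α), MeasurableSet D →
      (∀ w w' : ℕ → α, (∀ i < m, w i = w' i) → w ∈ D → w' ∈ D) →
      iid ν D = ∫⁻ w in D, ∏ i ∈ Finset.range m, f (w i) ∂(iid μ) := by
  induction m with
  | zero =>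
    intro D hD hdep
    -- A set depending on no coordinate is empty or everything.
    rcases D.eq_empty_or_nonempty with rfl | ⟨w, hw⟩
    · simp
    · have : D = univ := eq_univ_of_forall fun w' => hdep w w' (by simp) hw
      simp [this]
  | succ m ih =>
    intro D hD hdep
    have hprod : ∀ m, Measurable fun w : ℕ → α => ∏ i ∈ Finset.range m, f (w i) := fun m =>
      Finset.measurable_fun_prod _ fun i _ => hf.comp (measurable_pi_apply i)
    rw [← lintegral_indicator hD, lintegral_iid_consSeq μ ((hprod _).indicator hD),
      iid_apply_consSeq ν hD,
      lintegral_of_eq_withDensity hf hν (measurable_iid_consSeq ν hD)]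
    refine lintegral_congr fun a => ?_
    have hDa : MeasurableSet (consSeq a ⁻¹' D) := measurable_consSeq_right a hD
    have h1 := ih (consSeq a ⁻¹' D) hDa (fun w w' h hw => hdep _ _ (fun i hi => by
      cases i with
      | zero => rfl
      | succ i => exact h i (by omega)) hw)
    have h2 : ∀ w, D.indicator (fun w : ℕ → α => ∏ i ∈ Finset.range (m + 1), f (w i)) (consSeq a w)
        = f a * (consSeq a ⁻¹' D).indicator
          (fun w : ℕ → α => ∏ i ∈ Finset.range m, f (w i)) w := by
      intro w
      by_cases hw : consSeq a w ∈ D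
      · rw [indicator_of_mem hw, indicator_of_mem (by exact hw), Finset.prod_range_succ', mul_comm]
        rfl
      · rw [indicator_of_notMem hw, indicator_of_notMem (by exact hw), mul_zero]
    simp_rw [h2]
    rw [lintegral_const_mul _ ((hprod m).indicator hDa), lintegral_indicator hDa, ← h1]

/-! ### Arrival times and counts as functions of the interarrival times -/

/-- A point of `Omega` with prescribed interarrival times. -/
def ofW (w : ℕ → Pos) : Omega := ((w, w), w 0)

lemma measurable_ofW : Measurable ofW := by unfold ofW; fun_prop

/-- The arrival times as functions of the interarrival times. -/
def arrival (n : ℕ) (w : ℕ → Pos) : ℝ := T n (ofW w)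

/-- The counting process as a function of the interarrival times. -/
def count (t : ℝ≥0) (w : ℕ → Pos) : ℕ := N t (ofW w)

lemma N_eq_count (t : ℝ≥0) (ω : Omega) : N t ω = count t ω.1.1 := rfl

lemma arrival_eq (n : ℕ) (w : ℕ → Pos) : arrival n w = ∑ k ∈ Finset.range n, (w k : ℝ) := rfl

lemma measurable_arrival (n : ℕ) : Measurable (arrival n) :=
  (measurable_T n).comp measurable_ofW

lemma measurable_count (t : ℝ≥0) : Measurable (count t) :=
  (measurable_N t).comp measurable_ofW

lemma strictMono_arrival (w : ℕ → Pos) : StrictMono fun n => arrival n w := strictMono_T _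

lemma monotone_arrival (w : ℕ → Pos) {k l : ℕ} (h : k ≤ l) : arrival k w ≤ arrival l w :=
  (strictMono_arrival w).monotone h

@[simp] lemma arrival_zero (w : ℕ → Pos) : arrival 0 w = 0 := by simp [arrival_eq]

lemma arrival_nonneg (n : ℕ) (w : ℕ → Pos) : 0 ≤ arrival n w := by
  rw [arrival_eq]
  exact Finset.sum_nonneg fun i _ => (w i).2.le

lemma arrival_consSeq (n : ℕ) (a : Pos) (w : ℕ → Pos) :
    arrival (n + 1) (consSeq a w) = a + arrival n w := by
  rw [arrival_eq, Finset.sum_range_succ', add_comm, arrival_eq]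
  rfl

/-- The event that exactly `n` arrivals occur up to time `t`. -/
def slot (n : ℕ) (t : ℝ) : Set (ℕ → Pos) := {w | arrival n w ≤ t ∧ t < arrival (n + 1) w}

lemma measurableSet_slot (n : ℕ) (t : ℝ) : MeasurableSet (slot n t) :=
  (measurableSet_le (measurable_arrival n) measurable_const).inter
    (measurableSet_lt measurable_const (measurable_arrival (n + 1)))

/-- The renewal step. Time is a real number here, so that `s - a` may become negative without a case
distinction; the slot is then empty. -/
lemma consSeq_mem_slot_succ (k : ℕ) (s : ℝ) (a : Pos) (w : ℕ → Pos) :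
    consSeq a w ∈ slot (k + 1) s ↔ w ∈ slot k (s - a) := by
  simp only [slot, mem_ofPred_eq, arrival_consSeq]
  constructor <;> rintro ⟨h1, h2⟩ <;> constructor <;> linarith

lemma consSeq_mem_slot_zero (s : ℝ) (a : Pos) (w : ℕ → Pos) :
    consSeq a w ∈ slot 0 s ↔ 0 ≤ s ∧ s < a := by
  simp [slot, arrival_consSeq]

lemma slot_of_neg (k : ℕ) {s : ℝ} (hs : s < 0) : slot k s = ∅ := by
  ext w
  simp only [slot, mem_ofPred_eq, mem_empty_iff_false, iff_false, not_and]
  intro h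
  linarith [arrival_nonneg k w]

lemma slot_unique {k l : ℕ} {s : ℝ} {w : ℕ → Pos} (hk : w ∈ slot k s) (hl : w ∈ slot l s) :
    k = l := by
  rcases lt_trichotomy k l with h | h | h
  · have := monotone_arrival w (show k + 1 ≤ l by omega)
    have h1 := hk.2
    have h2 := hl.1
    linarith
  · exact h
  · have := monotone_arrival w (show l + 1 ≤ k by omega)
    have h1 := hl.2
    have h2 := hk.1
    linarith

lemma count_of_mem_slot {k : ℕ} {t : ℝ≥0} {w : ℕ → Pos} (h : w ∈ slot k t) : count t w = k := by
  cases k with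
  | succ k => exact (N_eq_succ_iff t (ofW w) k).2 h
  | zero =>
    cases hc : count t w with
    | zero => rfl
    | succ n => exact (slot_unique h ((N_eq_succ_iff t (ofW w) n).1 hc)).symm

/-- Only for positive counts: the value `0` is also taken when infinitely many arrivals occur up to
`t`. -/
lemma mem_slot_of_count_eq_succ {k : ℕ} {t : ℝ≥0} {w : ℕ → Pos} (h : count t w = k + 1) :
    w ∈ slot (k + 1) t := (N_eq_succ_iff t (ofW w) k).1 h

/-- The sequences of interarrival times without explosion. -/
def nonExplosive : Set (ℕ → Pos) := {w | ∀ c : ℝ, ∃ n, c < arrival n w}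

lemma mem_slot_count_of_lt {w : ℕ → Pos} {t : ℝ≥0} {n : ℕ} (h : (t : ℝ) < arrival n w) :
    w ∈ slot (count t w) t := by
  classical
  have hex : ∃ n, (t : ℝ) < arrival n w := ⟨n, h⟩
  have h1 := Nat.find_spec hex
  have h0 : Nat.find hex ≠ 0 := by
    intro h
    rw [h, arrival_zero] at h1
    exact absurd t.2 (not_le.2 h1)
  obtain ⟨k, hk⟩ := Nat.exists_eq_succ_of_ne_zero h0
  have h2 : ¬ (t : ℝ) < arrival k w := Nat.find_min hex (by omega)
  have h3 : w ∈ slot k t := ⟨not_lt.1 h2, by rw [hk] at h1; exact h1⟩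
  rwa [count_of_mem_slot h3]

lemma mem_slot_count {w : ℕ → Pos} (hw : w ∈ nonExplosive) (t : ℝ≥0) :
    w ∈ slot (count t w) t :=
  (hw t).elim fun _ => mem_slot_count_of_lt

lemma le_count_iff {w : ℕ → Pos} (hw : w ∈ nonExplosive) (t : ℝ≥0) (k : ℕ) :
    k ≤ count t w ↔ arrival k w ≤ t := by
  have h := mem_slot_count hw t
  constructor
  · intro hk
    exact (monotone_arrival w hk).trans h.1
  · intro hk
    by_contra hc
    have := monotone_arrival w (show count t w + 1 ≤ k by omega)
    linarith [h.2]

lemma count_mono {w : ℕ → Pos} (hw : w ∈ nonExplosive) {s t : ℝ≥0} (hst : s ≤ t) :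
    count s w ≤ count t w := by
  rw [le_count_iff hw]
  exact (mem_slot_count hw s).1.trans (by exact_mod_cast hst)

/-! ### The exponential distribution on `(0, ∞)` -/

/-- The retraction of the real line onto `(0, ∞)` sending the nonpositive numbers to `1`. -/
def posOf (x : ℝ) : Pos := if h : 0 < x then ⟨x, mem_Ioi.2 h⟩ else ⟨1, mem_Ioi.2 one_pos⟩

lemma posOf_of_pos {x : ℝ} (h : 0 < x) : posOf x = ⟨x, mem_Ioi.2 h⟩ := dif_pos h

lemma coe_posOf {x : ℝ} (h : 0 < x) : (posOf x : ℝ) = x := by rw [posOf_of_pos h]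

@[simp] lemma posOf_coe (a : Pos) : posOf (a : ℝ) = a := posOf_of_pos a.2

lemma measurable_posOf : Measurable posOf := by
  have h : Measurable fun x => (posOf x : ℝ) := by
    have : (fun x => (posOf x : ℝ)) = fun x => if 0 < x then x else 1 := by
      ext x
      unfold posOf
      split_ifs <;> rfl
    rw [this]
    exact Measurable.ite measurableSet_Ioi measurable_id measurable_const
  exact h.subtype_mk

lemma lintegral_expPos (θ : Pos) {H : Pos → ℝ≥0∞} (hH : Measurable H) :
    ∫⁻ a, H a ∂(expPos θ)
      = ∫⁻ x in Ioi (0 : ℝ), ENNReal.ofReal (θ * Real.exp (-(θ * x))) * H (posOf x) := by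
  have h1 : ∫⁻ a, H a ∂(expPos θ)
      = ∫⁻ x, H (posOf x) ∂((expPos θ).map Subtype.val) := by
    rw [lintegral_map (f := fun x => H (posOf x)) (hH.comp measurable_posOf)
      measurable_subtype_coe]
    simp
  rw [h1, expPos, (MeasurableEmbedding.subtype_coe measurableSet_Ioi).map_comap,
    Subtype.range_coe, expMeasure, gammaMeasure, restrict_withDensity measurableSet_Ioi,
    lintegral_withDensity_eq_lintegral_mul _ ?_ (g := fun x => H (posOf x))
      (hH.comp measurable_posOf)]
  · refine setLIntegral_congr_fun measurableSet_Ioi fun x hx => ?_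
    have := exponentialPDF_of_nonneg (r := (θ : ℝ)) (x := x) (le_of_lt hx)
    simp only [exponentialPDF] at this
    simp only [Pi.mul_apply]
    congr 1
  · exact (measurable_exponentialPDFReal θ).ennreal_ofReal

/-- The change of rate for a single interarrival time; `iid_expPos_slot_inter` multiplies these
factors. -/
lemma expPos_eq_withDensity (r θ : Pos) :
    expPos r = (expPos θ).withDensity
      fun a => ENNReal.ofReal (r / θ * Real.exp (-((r - θ) * a))) := by
  have hm : Measurable fun a : Pos => ENNReal.ofReal (r / θ * Real.exp (-((r - θ) * a))) := by
    fun_prop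
  ext D hD
  rw [withDensity_apply _ hD, ← lintegral_indicator hD, ← lintegral_indicator_one hD,
    lintegral_expPos r (measurable_one.indicator hD), lintegral_expPos θ (hm.indicator hD)]
  refine setLIntegral_congr_fun measurableSet_Ioi fun x hx => ?_
  by_cases hxD : posOf x ∈ D
  · simp only [indicator_of_mem hxD, Pi.one_apply, mul_one]
    rw [coe_posOf hx, ← ENNReal.ofReal_mul (mul_nonneg θ.2.le (Real.exp_pos _).le)]
    congr 1
    have : (θ : ℝ) ≠ 0 := ne_of_gt θ.2
    rw [show -((r : ℝ) * x) = -(θ * x) + -((r - θ) * x) by ring, Real.exp_add]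
    field_simp
  · simp [indicator_of_notMem hxD]

/-- The exponential distribution is memoryless. -/
lemma lintegral_expPos_memoryless (r : Pos) {s : ℝ} (hs : 0 ≤ s) {H : Pos → ℝ≥0∞}
    (hH : Measurable H) :
    ∫⁻ a, (if s < (a : ℝ) then H (posOf (a - s)) else 0) ∂(expPos r)
      = ENNReal.ofReal (Real.exp (-(r * s))) * ∫⁻ a, H a ∂(expPos r) := by
  have hm1 : Measurable fun a : Pos => if s < (a : ℝ) then H (posOf (a - s)) else 0 := by
    refine Measurable.ite (measurableSet_lt measurable_const measurable_subtype_coe) ?_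
      measurable_const
    exact hH.comp (measurable_posOf.comp (measurable_subtype_coe.sub_const s))
  have hm2 : Measurable fun x : ℝ =>
      ENNReal.ofReal (r * Real.exp (-(r * x))) * H (posOf x) :=
    Measurable.mul (by fun_prop) (hH.comp measurable_posOf)
  rw [lintegral_expPos r hm1, lintegral_expPos r hH, ← lintegral_const_mul _ hm2,
    ← lintegral_indicator measurableSet_Ioi, ← lintegral_indicator measurableSet_Ioi]
  -- Translation invariance of Lebesgue measure aligns the two integrals, which then agree
  -- pointwise.
  conv_rhs => rw [← lintegral_sub_right_eq_self _ s]
  refine lintegral_congr fun x => ?_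
  by_cases hx : s < x
  · have h0 : 0 < x := hs.trans_lt hx
    rw [indicator_of_mem (show x ∈ Ioi (0 : ℝ) from h0),
      indicator_of_mem (show x - s ∈ Ioi (0 : ℝ) from sub_pos.2 hx), coe_posOf h0, if_pos hx,
      ← mul_assoc, ← ENNReal.ofReal_mul (Real.exp_pos _).le]
    congr 2
    rw [show -((r : ℝ) * x) = -(r * s) + -(r * (x - s)) by ring, Real.exp_add]
    ring
  · rw [indicator_of_notMem (show ¬ x - s ∈ Ioi (0 : ℝ) by simpa using hx)]
    by_cases h0 : 0 < x
    · rw [indicator_of_mem (show x ∈ Ioi (0 : ℝ) from h0), coe_posOf h0, if_neg hx, mul_zero]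
    · rw [indicator_of_notMem (show ¬ x ∈ Ioi (0 : ℝ) from h0)]

lemma expPos_Ioi (r : Pos) {s : ℝ} (hs : 0 ≤ s) :
    expPos r {a | s < (a : ℝ)} = ENNReal.ofReal (Real.exp (-(r * s))) := by
  have h := lintegral_expPos_memoryless r hs (H := fun _ => 1) measurable_const
  have hms : MeasurableSet {a : Pos | s < (a : ℝ)} :=
    measurableSet_lt measurable_const measurable_subtype_coe
  rw [← lintegral_indicator_one hms]
  simpa [indicator_apply] using h

/-! ### Change of the arrival rate -/

/-- On the event of `m` arrivals up to time `t`, a change of the rate from `θ` to `r` multiplies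
the law of the arrivals up to time `t` by `(r / θ) ^ m * exp (-(r - θ) * t)`. -/
lemma iid_expPos_slot_inter (r θ : Pos) (m : ℕ) :
    ∀ (t : ℝ) (D : Set (ℕ → Pos)), MeasurableSet D →
      (∀ w w', w ∈ slot m t → w' ∈ slot m t → (∀ i < m, w i = w' i) → w ∈ D → w' ∈ D) →
      iid (expPos r) (slot m t ∩ D)
        = ENNReal.ofReal ((r / θ) ^ m * Real.exp (-((r - θ) * t)))
          * iid (expPos θ) (slot m t ∩ D) := by
  have hrθ : 0 < (r : ℝ) / θ := div_pos r.2 θ.2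
  induction m with
  | zero =>
    intro t D hD hdep
    -- Without arrivals `D` cannot split the slot, so only the probability `exp (-r t)` of a first
    -- arrival after `t` matters.
    rcases (slot 0 t ∩ D).eq_empty_or_nonempty with h | ⟨w, hw1, hw2⟩
    · simp [h]
    · have h0 : slot 0 t ∩ D = slot 0 t :=
        inter_eq_left.2 fun w' hw' => hdep w w' hw1 hw' (by simp) hw2
      have ht : 0 ≤ t := by simpa using hw1.1
      have hs : ∀ r : Pos, iid (expPos r) (slot 0 t) = ENNReal.ofReal (Real.exp (-(r * t))) := by
        intro r
        have : slot 0 t = (fun w : ℕ → Pos => w 0) ⁻¹' {a | t < (a : ℝ)} := by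
          ext w
          simp [slot, arrival_eq, ht]
        have hms : MeasurableSet {a : Pos | t < (a : ℝ)} :=
          measurableSet_lt measurable_const measurable_subtype_coe
        rw [this, ← expPos_Ioi r ht, ← Measure.map_apply (by fun_prop) hms]
        congr 1
        exact Measure.infinitePi_map_eval (fun _ : ℕ => expPos r) 0
      rw [h0, hs, hs, pow_zero, one_mul, ← ENNReal.ofReal_mul (Real.exp_pos _).le, ← Real.exp_add]
      congr 2
      ring
  | succ m ih =>
    intro t D hD hdep
    have hms := measurableSet_slot (m + 1) t
    have hm : Measurable fun a : Pos => ENNReal.ofReal (r / θ * Real.exp (-((r - θ) * a))) := by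
      fun_prop
    rw [iid_apply_consSeq _ (hms.inter hD), iid_apply_consSeq _ (hms.inter hD),
      lintegral_of_eq_withDensity hm (expPos_eq_withDensity r θ)
        (measurable_iid_consSeq _ (hms.inter hD)),
      ← lintegral_const_mul _ (measurable_iid_consSeq _ (hms.inter hD))]
    refine lintegral_congr fun a => ?_
    have hpre : consSeq a ⁻¹' (slot (m + 1) t ∩ D) = slot m (t - a) ∩ consSeq a ⁻¹' D := by
      ext w
      simp only [mem_preimage, mem_inter_iff, consSeq_mem_slot_succ]
    -- The first interarrival time `a` contributes `r / θ * exp (-(r - θ) * a)`, the remaining ones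
    -- contribute the factor for time `t - a`; the exponents add up to a quantity free of `a`.
    rw [hpre, ih (t - a) _ (measurable_consSeq_right a hD), ← mul_assoc,
      ← ENNReal.ofReal_mul (mul_pos hrθ (Real.exp_pos _)).le]
    · congr 2
      rw [show -(((r : ℝ) - θ) * t) = -((r - θ) * a) + -((r - θ) * (t - a)) by ring, Real.exp_add]
      ring
    · intro w w' hw hw' h
      refine hdep _ _ ((consSeq_mem_slot_succ _ _ _ _).2 hw)
        ((consSeq_mem_slot_succ _ _ _ _).2 hw') fun i hi => ?_
      cases i with
      | zero => rfl
      | succ i => exact h i (by omega)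

/-! ### Restarting the process of the arrivals -/

/-- The probabilities of the Poisson distribution with parameter `r * s`, extended by zero to
negative `s`. -/
def poissonProb (k : ℕ) (r : Pos) (s : ℝ) : ℝ≥0∞ :=
  if 0 ≤ s then ENNReal.ofReal (Real.exp (-(r * s)) * (r * s) ^ k / k.factorial) else 0

lemma poissonProb_coe (k : ℕ) (r : Pos) (s : ℝ≥0) :
    poissonProb k r s = poissonMeasure (s * (r : ℝ).toNNReal) {k} := by
  rw [poissonProb, if_pos (NNReal.coe_nonneg s), poissonMeasure_singleton]
  have : ((s * (r : ℝ).toNNReal : ℝ≥0) : ℝ) = r * s := by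
    rw [NNReal.coe_mul, Real.coe_toNNReal _ r.2.le, mul_comm]
  rw [this]

/-- Conditioning on the first arrival: the exponentials combine to `exp (-r s)`, and integrating `(s
- x) ^ k` over `(0, s]` gives `s ^ (k + 1) / (k + 1)`, which turns `k!` into `(k + 1)!`. -/
lemma lintegral_poissonProb (k : ℕ) (r : Pos) (s : ℝ) :
    ∫⁻ a, poissonProb k r (s - a) ∂(expPos r) = poissonProb (k + 1) r s := by
  have hm : Measurable fun a : ℝ => poissonProb k r (s - a) :=
    Measurable.ite (measurableSet_le measurable_const (by fun_prop)) (by fun_prop) measurable_const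
  rw [lintegral_expPos r (H := fun a => poissonProb k r (s - a))
    (hm.comp measurable_subtype_coe), ← lintegral_indicator measurableSet_Ioi]
  by_cases hs : 0 ≤ s
  · have hfun : ∀ x : ℝ, (Ioi (0 : ℝ)).indicator
        (fun x => ENNReal.ofReal (r * Real.exp (-(r * x))) * poissonProb k r (s - posOf x)) x
        = (Ioc 0 s).indicator (fun x => ENNReal.ofReal
          (Real.exp (-(r * s)) * r ^ (k + 1) / k.factorial * (s - x) ^ k)) x := by
      intro x
      by_cases hx : 0 < x
      · rw [indicator_of_mem (show x ∈ Ioi (0 : ℝ) from hx), coe_posOf hx]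
        by_cases hxs : x ≤ s
        · rw [indicator_of_mem (show x ∈ Ioc 0 s from ⟨hx, hxs⟩), poissonProb,
            if_pos (sub_nonneg.2 hxs), ← ENNReal.ofReal_mul (mul_pos r.2 (Real.exp_pos _)).le]
          congr 1
          rw [show -((r : ℝ) * s) = -(r * x) + -(r * (s - x)) by ring, Real.exp_add, mul_pow,
            pow_succ]
          ring
        · rw [indicator_of_notMem (by simp [hxs]), poissonProb, if_neg (by simpa using hxs),
            mul_zero]
      · rw [indicator_of_notMem (by simpa using hx), indicator_of_notMem (by simp [hx])]
    simp_rw [hfun]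
    rw [lintegral_indicator measurableSet_Ioc, ← ofReal_integral_eq_lintegral_ofReal,
      integral_const_mul, ← intervalIntegral.integral_of_le hs,
      intervalIntegral.integral_comp_sub_left (fun x => x ^ k), integral_pow, poissonProb, if_pos hs]
    · congr 1
      rw [Nat.factorial_succ]
      push_cast
      have : (k.factorial : ℝ) ≠ 0 := by positivity
      field_simp
      simp
      ring
    · exact (Continuous.integrableOn_Icc (by fun_prop)).mono_set Ioc_subset_Icc_self
    · filter_upwards [ae_restrict_mem measurableSet_Ioc] with x hx
      have := r.2
      have h1 : 0 ≤ s - x := sub_nonneg.2 hx.2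
      have h2 : (0 : ℝ) < r := r.2
      simp only [Pi.zero_apply]
      positivity
  · have hfun : ∀ x : ℝ, (Ioi (0 : ℝ)).indicator
        (fun x => ENNReal.ofReal (r * Real.exp (-(r * x))) * poissonProb k r (s - posOf x)) x
        = 0 := by
      intro x
      by_cases hx : 0 < x
      · rw [indicator_of_mem (show x ∈ Ioi (0 : ℝ) from hx), coe_posOf hx, poissonProb,
          if_neg (by linarith), mul_zero]
      · rw [indicator_of_notMem (by simpa using hx)]
    simp_rw [hfun]
    rw [poissonProb, if_neg hs, lintegral_zero]

/-- The interarrival times after time `s`, if `k` arrivals occur up to time `s`. -/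
def restartAt (k : ℕ) (s : ℝ) (w : ℕ → Pos) : ℕ → Pos :=
  consSeq (posOf (arrival (k + 1) w - s)) fun j => w (k + 1 + j)

lemma measurable_restartAt (k : ℕ) (s : ℝ) : Measurable (restartAt k s) :=
  measurable_consSeq.comp ((measurable_posOf.comp ((measurable_arrival _).sub_const s)).prodMk
    (measurable_pi_lambda _ fun _ => measurable_pi_apply _))

lemma restartAt_consSeq_succ (k : ℕ) (s : ℝ) (a : Pos) (w : ℕ → Pos) :
    restartAt (k + 1) s (consSeq a w) = restartAt k (s - a) w := by
  rw [restartAt, restartAt, arrival_consSeq]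
  congr 2
  · ring
  · ext j
    rw [show k + 1 + 1 + j = (k + 1 + j) + 1 by ring]
    rfl

lemma restartAt_consSeq_zero (s : ℝ) (a : Pos) (w : ℕ → Pos) :
    restartAt 0 s (consSeq a w) = consSeq (posOf (a - s)) w := by
  rw [restartAt, arrival_consSeq]
  congr 2
  · simp
  · ext j
    rw [show 0 + 1 + j = j + 1 by ring]
    rfl

/-- The Markov property at a deterministic time: the count up to `s` is Poisson and independent of
the restarted sequence, which has the original law. For `k = 0` this is memorylessness applied to
the first interarrival time; otherwise the first interarrival time is peeled off and integrated by
`lintegral_poissonProb`. -/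
lemma iid_expPos_slot_restartAt (r : Pos) (k : ℕ) :
    ∀ (s : ℝ) (B : Set (ℕ → Pos)), MeasurableSet B →
      iid (expPos r) (slot k s ∩ restartAt k s ⁻¹' B)
        = poissonProb k r s * iid (expPos r) B := by
  induction k with
  | zero =>
    intro s B hB
    rw [iid_apply_consSeq _ ((measurableSet_slot _ _).inter (measurable_restartAt _ _ hB))]
    by_cases hs : 0 ≤ s
    · have h := lintegral_expPos_memoryless r hs (measurable_iid_consSeq (expPos r) hB)
      rw [← iid_apply_consSeq _ hB] at h
      rw [poissonProb, if_pos hs, pow_zero, Nat.factorial_zero, Nat.cast_one, div_one, mul_one, ← h]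
      refine lintegral_congr fun a => ?_
      split_ifs with ha
      · congr 1
        ext w
        simp [consSeq_mem_slot_zero, hs, ha, restartAt_consSeq_zero]
      · rw [← measure_empty (μ := iid (expPos r))]
        congr 1
        ext w
        simp [consSeq_mem_slot_zero, ha]
    · rw [poissonProb, if_neg hs, slot_of_neg _ (not_le.1 hs)]
      simp
  | succ k ih =>
    intro s B hB
    have hm : Measurable fun a : Pos => poissonProb k r (s - a) :=
      Measurable.ite (measurableSet_le measurable_const (by fun_prop)) (by fun_prop)
        measurable_const
    rw [iid_apply_consSeq _ ((measurableSet_slot _ _).inter (measurable_restartAt _ _ hB)),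
      ← lintegral_poissonProb, ← lintegral_mul_const _ hm]
    refine lintegral_congr fun a => ?_
    rw [← ih (s - a) B hB]
    congr 1
    ext w
    simp only [mem_preimage, mem_inter_iff, consSeq_mem_slot_succ, restartAt_consSeq_succ]

lemma iid_expPos_slot (r : Pos) (k : ℕ) (s : ℝ) :
    iid (expPos r) (slot k s) = poissonProb k r s := by
  simpa using iid_expPos_slot_restartAt r k s univ MeasurableSet.univ

/-- At each integer time the probabilities of the slots are Poisson probabilities and sum to one, so
almost surely some slot occurs. No law of large numbers is needed. -/
lemma ae_nonExplosive (r : Pos) : ∀ᵐ w ∂(iid (expPos r)), w ∈ nonExplosive := by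
  have h : ∀ c : ℕ, ∀ᵐ w ∂(iid (expPos r)), w ∈ ⋃ k, slot k c := by
    intro c
    have hm : MeasurableSet (⋃ k, slot k (c : ℝ)) :=
      MeasurableSet.iUnion fun k => measurableSet_slot k _
    refine (mem_ae_iff_prob_eq_one hm).2 ?_
    rw [measure_iUnion (fun k l hkl => Set.disjoint_left.2 fun w hk hl => hkl (slot_unique hk hl))
      fun k => measurableSet_slot k _]
    have h1 : ∀ k, iid (expPos r) (slot k (c : ℝ))
        = poissonMeasure ((c : ℝ≥0) * (r : ℝ).toNNReal) {k} := fun k => by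
      rw [iid_expPos_slot, ← poissonProb_coe, NNReal.coe_natCast]
    simp_rw [h1]
    rw [← measure_iUnion (fun k l hkl => by simpa using hkl) fun k => measurableSet_singleton k,
      iUnion_of_singleton, measure_univ]
  filter_upwards [ae_all_iff.2 h] with w hw c
  obtain ⟨n, hn⟩ := exists_nat_gt c
  obtain ⟨k, hk⟩ := mem_iUnion.1 (hw n)
  exact ⟨k + 1, hn.trans hk.2⟩

lemma arrival_restartAt {k : ℕ} {s : ℝ} {w : ℕ → Pos} (h : s < arrival (k + 1) w) (m : ℕ) :
    arrival (m + 1) (restartAt k s w) = arrival (k + m + 1) w - s := by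
  rw [restartAt, arrival_consSeq, coe_posOf (sub_pos.2 h), show k + m + 1 = k + 1 + m by ring,
    arrival_eq (k + 1 + m), Finset.sum_range_add, ← arrival_eq (k + 1), arrival_eq m]
  ring

/-- The interarrival times after time `s`. -/
def restart (s : ℝ≥0) (w : ℕ → Pos) : ℕ → Pos := restartAt (count s w) s w

lemma arrival_restart {w : ℕ → Pos} (hw : w ∈ nonExplosive) (s : ℝ≥0) (m : ℕ) :
    arrival (m + 1) (restart s w) = arrival (count s w + m + 1) w - s :=
  arrival_restartAt (mem_slot_count hw s).2 m

lemma nonExplosive_restart {w : ℕ → Pos} (hw : w ∈ nonExplosive) (s : ℝ≥0) :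
    restart s w ∈ nonExplosive := by
  intro c
  obtain ⟨n, hn⟩ := hw (c + s)
  refine ⟨n + 1, ?_⟩
  rw [arrival_restart hw]
  have := monotone_arrival w (show n ≤ count s w + n + 1 by omega)
  linarith

lemma count_add {w : ℕ → Pos} (hw : w ∈ nonExplosive) (s u : ℝ≥0) :
    count (s + u) w = count s w + count u (restart s w) := by
  have hle := count_mono hw (le_self_add : s ≤ s + u)
  have hs := mem_slot_count hw s
  have hl := mem_slot_count hw (s + u)
  obtain ⟨m, hm⟩ := Nat.exists_eq_add_of_le hle
  rw [hm] at hl ⊢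
  congr 1
  refine (count_of_mem_slot ⟨?_, ?_⟩).symm
  · cases m with
    | zero => simp
    | succ m =>
      rw [arrival_restart hw]
      have := hl.1
      push_cast at this
      rw [← add_assoc] at this
      linarith
  · rw [arrival_restart hw]
    have := hl.2
    push_cast at this
    linarith

lemma measurable_restart (s : ℝ≥0) : Measurable (restart s) := by
  have h1 : Measurable (Function.uncurry fun k : ℕ => restartAt k s) :=
    measurable_from_prod_countable_right fun k => measurable_restartAt k s
  have h2 : Measurable fun w => (count s w, w) := (measurable_count s).prodMk measurable_id
  have h3 : restart s = (Function.uncurry fun k : ℕ => restartAt k s) ∘ fun w => (count s w, w) :=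
    rfl
  rw [h3]
  exact h1.comp h2

/-- Replaces slots by counts in `iid_expPos_slot_restartAt`; they agree off the null set of
explosive sequences. -/
lemma iid_count_restart (r : Pos) (s : ℝ≥0) (k : ℕ) {B : Set (ℕ → Pos)} (hB : MeasurableSet B) :
    iid (expPos r) (count s ⁻¹' {k} ∩ restart s ⁻¹' B)
      = poissonMeasure (s * (r : ℝ).toNNReal) {k} * iid (expPos r) B := by
  rw [← poissonProb_coe, ← iid_expPos_slot_restartAt r k s B hB]
  refine measure_congr ?_
  filter_upwards [ae_nonExplosive r] with w hw
  refine propext ⟨?_, ?_⟩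
  · rintro ⟨h1, h2⟩
    have h1 : count s w = k := h1
    have h2 : restart s w ∈ B := h2
    subst h1
    exact ⟨mem_slot_count hw s, h2⟩
  · rintro ⟨h1, h2⟩
    have h := count_of_mem_slot h1
    have h2 : restartAt k s w ∈ B := h2
    subst h
    exact ⟨rfl, h2⟩

lemma map_restart_iid (r : Pos) (s : ℝ≥0) :
    (iid (expPos r)).map (restart s) = iid (expPos r) := by
  ext B hB
  rw [Measure.map_apply (measurable_restart s) hB]
  have h : restart s ⁻¹' B = ⋃ k, count s ⁻¹' {k} ∩ restart s ⁻¹' B := by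
    rw [← iUnion_inter, ← preimage_iUnion, iUnion_of_singleton, preimage_univ, univ_inter]
  rw [h, measure_iUnion]
  · simp_rw [iid_count_restart r s _ hB, ENNReal.tsum_mul_right]
    rw [← measure_iUnion (fun k l hkl => by simpa using hkl) fun k => measurableSet_singleton k,
      iUnion_of_singleton, measure_univ, one_mul]
  · intro k l hkl
    refine Set.disjoint_left.2 fun w hk hl => hkl ?_
    exact (show count s w = k from hk.1).symm.trans hl.1
  · exact fun k => (measurable_count s (measurableSet_singleton k)).inter (measurable_restart s hB)

lemma map_count_iid (r : Pos) (t : ℝ≥0) :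
    (iid (expPos r)).map (count t) = poissonMeasure (t * (r : ℝ).toNNReal) := by
  refine Measure.ext_of_singleton fun k => ?_
  rw [Measure.map_apply (measurable_count t) (measurableSet_singleton k)]
  simpa using iid_count_restart r t k MeasurableSet.univ

/-- The increments of the counting process as functions of the interarrival times. -/
def incrCount {n : ℕ} (t : Fin (n + 1) → ℝ≥0) (w : ℕ → Pos) (i : Fin n) : ℤ :=
  (count (t i.succ) w : ℤ) - count (t i.castSucc) w

lemma measurable_incrCount {n : ℕ} (t : Fin (n + 1) → ℝ≥0) : Measurable (incrCount t) := by
  refine measurable_pi_lambda _ fun i => ?_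
  exact ((measurable_of_countable (Nat.cast : ℕ → ℤ)).comp (measurable_count _)).sub
    ((measurable_of_countable (Nat.cast : ℕ → ℤ)).comp (measurable_count _))

/-- The law of an increment of a Poisson process with rate `r` over an interval of length `s`. -/
abbrev incrLaw (r : Pos) (s : ℝ≥0) : Measure ℤ :=
  (poissonMeasure (s * (r : ℝ).toNNReal)).map (Nat.cast : ℕ → ℤ)

instance (r : Pos) (s : ℝ≥0) : IsProbabilityMeasure (incrLaw r s) :=
  Measure.isProbabilityMeasure_map (measurable_of_countable _).aemeasurable

/-- Two restarts are used: at `t 0`, which need not be zero, and then after the further time `t 1 -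
t 0`, so that the head increment becomes a count and the tail an increment vector of the twice
restarted sequence. -/
lemma incrCount_iff {n : ℕ} {t : Fin (n + 2) → ℝ≥0} (ht : Monotone t) {w : ℕ → Pos}
    (hw : w ∈ nonExplosive) (k : Fin (n + 1) → ℤ) :
    incrCount t w = k ↔ (count (t 1 - t 0) (restart (t 0) w) : ℤ) = k 0 ∧
      incrCount (fun i => t i.succ - t 1) (restart (t 1 - t 0) (restart (t 0) w))
        = fun i => k i.succ := by
  have hw1 := nonExplosive_restart hw (t 0)
  have h01 : t 0 ≤ t 1 := ht (Fin.zero_le _)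
  have hc : ∀ i : Fin (n + 1), count (t i.succ) w = count (t 0) w +
      (count (t 1 - t 0) (restart (t 0) w)
        + count (t i.succ - t 1) (restart (t 1 - t 0) (restart (t 0) w))) := by
    intro i
    have h1 : t 1 ≤ t i.succ := ht (by rw [← Fin.succ_zero_eq_one]; exact Fin.succ_le_succ_iff.2 (Fin.zero_le _))
    rw [← count_add hw1, ← count_add hw]
    congr 1
    rw [← add_assoc, add_tsub_cancel_of_le h01, add_tsub_cancel_of_le h1]
  have hc0 : count (t 1) w = count (t 0) w + count (t 1 - t 0) (restart (t 0) w) := by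
    rw [← count_add hw, add_tsub_cancel_of_le h01]
  rw [funext_iff, funext_iff, Fin.forall_fin_succ]
  refine and_congr ?_ (forall_congr' fun i => ?_)
  · simp only [incrCount, Fin.succ_zero_eq_one, Fin.castSucc_zero, hc0]
    push_cast
    rw [add_sub_cancel_left]
  · simp only [incrCount, hc, Fin.castSucc_succ]
    push_cast
    rw [add_sub_add_left_eq_sub, add_sub_add_left_eq_sub]

/-- Invariance of the law under the first restart removes `t 0`; independence of count and restarted
sequence at the second splits off the first factor. -/
lemma iid_incrCount_singleton (r : Pos) (n : ℕ) : ∀ (t : Fin (n + 1) → ℝ≥0), Monotone t →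
    ∀ k : Fin n → ℤ, iid (expPos r) (incrCount t ⁻¹' {k})
      = ∏ i, incrLaw r (t i.succ - t i.castSucc) {k i} := by
  induction n with
  | zero =>
    intro t _ k
    have : incrCount t ⁻¹' {k} = univ := eq_univ_of_forall fun w => Subsingleton.elim _ _
    rw [this, measure_univ]
    simp
  | succ n ih =>
    intro t ht k
    have hm : Monotone fun i : Fin (n + 1) => t i.succ - t 1 := fun i j hij =>
      tsub_le_tsub_right (ht (Fin.succ_le_succ_iff.2 hij)) _
    set B := restart (t 1 - t 0) ⁻¹' (incrCount (fun i => t i.succ - t 1) ⁻¹' {fun i => k i.succ})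
    have hB : MeasurableSet B :=
      measurable_restart _ (measurable_incrCount _ (measurableSet_singleton _))
    have h1 : iid (expPos r) (incrCount t ⁻¹' {k})
        = iid (expPos r) (count (t 1 - t 0) ⁻¹' (Nat.cast ⁻¹' {k 0}) ∩ B) := by
      conv_rhs => rw [← map_restart_iid r (t 0)]
      rw [Measure.map_apply (measurable_restart _)
        ((measurable_count _ (Set.to_countable _).measurableSet).inter hB)]
      refine measure_congr ?_
      filter_upwards [ae_nonExplosive r] with w hw
      exact propext (incrCount_iff ht hw k)
    rw [h1, Fin.prod_univ_succ, Fin.succ_zero_eq_one, Fin.castSucc_zero,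
      Measure.map_apply (measurable_of_countable _) (measurableSet_singleton _)]
    have h2 := ih _ hm fun i => k i.succ
    have h3 : ∀ i : Fin n, t i.succ.succ - t 1 - (t i.castSucc.succ - t 1)
        = t i.succ.succ - t i.succ.castSucc := fun i => by
      rw [Fin.castSucc_succ]
      refine tsub_tsub_tsub_cancel_right (ht ?_)
      rw [← Fin.succ_zero_eq_one]
      exact Fin.succ_le_succ_iff.2 (Fin.zero_le _)
    simp only [h3] at h2
    rw [← h2]
    -- The increments are integer valued, so negative targets must be dealt with; both sides vanish.
    rcases lt_or_ge (k 0) 0 with h0 | h0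
    · have : (Nat.cast ⁻¹' {k 0} : Set ℕ) = ∅ := by
        ext j
        simp only [mem_preimage, mem_singleton_iff, mem_empty_iff_false, iff_false]
        omega
      rw [this]
      simp
    · obtain ⟨m, hm⟩ := Int.eq_ofNat_of_zero_le h0
      have : (Nat.cast ⁻¹' {k 0} : Set ℕ) = {m} := by
        ext j
        simp only [mem_preimage, mem_singleton_iff]
        omega
      rw [this, iid_count_restart r _ m
        (measurable_incrCount _ (measurableSet_singleton fun i : Fin n => k i.succ))]

/-- The increments of the renewal process with exponential interarrival times are independent and
Poisson distributed. -/
lemma map_incrCount_iid (r : Pos) {n : ℕ} {t : Fin (n + 1) → ℝ≥0} (ht : Monotone t) :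
    (iid (expPos r)).map (incrCount t)
      = Measure.pi fun i => incrLaw r (t i.succ - t i.castSucc) := by
  refine Measure.ext_of_singleton fun k => ?_
  rw [Measure.map_apply (measurable_incrCount t) (measurableSet_singleton k),
    iid_incrCount_singleton r n t ht, Measure.pi_singleton]

/-! ### Counting processes -/

lemma measurableSet_nonExplosive : MeasurableSet nonExplosive := by
  have : nonExplosive = ⋂ c : ℕ, ⋃ n, {w | (c : ℝ) < arrival n w} := by
    ext w
    simp only [nonExplosive, mem_ofPred_eq, mem_iInter, mem_iUnion]
    refine ⟨fun h c => h c, fun h c => ?_⟩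
    obtain ⟨m, hm⟩ := exists_nat_gt c
    obtain ⟨n, hn⟩ := h m
    exact ⟨n, hm.trans hn⟩
  rw [this]
  exact MeasurableSet.iInter fun c => MeasurableSet.iUnion fun n =>
    measurableSet_lt measurable_const (measurable_arrival n)

/-- Positivity of the interarrival times forces all path properties once explosion is excluded.
Conversely, an exploding path falls back to `0`, which contradicts being monotone and unbounded. -/
lemma isCountingProcess_iff (Q : Measure Omega) :
    IsCountingProcess Q ↔ ∀ᵐ ω ∂Q, ω.1.1 ∈ nonExplosive := by
  refine ⟨fun h => ?_, fun h => ?_⟩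
  · filter_upwards [h] with ω hω
    obtain ⟨-, hmono, -, -, hunb⟩ := hω
    by_contra hc
    simp only [nonExplosive, mem_ofPred_eq, not_forall, not_exists, not_lt] at hc
    obtain ⟨c, hc⟩ := hc
    -- All arrivals lie below `c`, and an infinite set has `ncard` zero.
    have hzero : ∀ t : ℝ≥0, c ≤ t → N t ω = 0 := by
      intro t ht
      have : {n : ℕ | T (n + 1) ω ≤ t} = univ :=
        eq_univ_of_forall fun n => (hc (n + 1)).trans ht
      rw [N, this, Set.Infinite.ncard Set.infinite_univ]
    obtain ⟨t, ht⟩ := hunb 1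
    have h1 := hmono (le_max_left t c.toNNReal)
    have h2 := hzero (max t c.toNNReal) ((Real.le_coe_toNNReal c).trans
      (by exact_mod_cast le_max_right t c.toNNReal))
    simp only [h2] at h1
    omega
  · filter_upwards [h] with ω hω
    have hN : ∀ t, N t ω = count t ω.1.1 := fun t => rfl
    generalize ω.1.1 = w at hω hN
    simp only [hN]
    refine ⟨?_, fun s t hst => count_mono hω hst, fun t => ?_, fun t ht => ?_, fun n => ?_⟩
    · refine count_of_mem_slot ⟨by simp, ?_⟩
      have := strictMono_arrival w (show 0 < 0 + 1 by norm_num)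
      simpa using this
    · have hev : ∀ᶠ s in nhdsWithin t (Ioi t), count s w = count t w := by
        have hlt := (mem_slot_count hω t).2
        have h1 : ∀ᶠ s : ℝ≥0 in nhds t, (s : ℝ) < arrival (count t w + 1) w :=
          NNReal.continuous_coe.continuousAt.eventually_lt continuousAt_const hlt
        filter_upwards [nhdsWithin_le_nhds h1, self_mem_nhdsWithin] with s hs hst
        refine count_of_mem_slot ⟨(mem_slot_count hω t).1.trans ?_, hs⟩
        exact_mod_cast (le_of_lt hst)
      exact (tendsto_congr' hev).2 tendsto_const_nhds
    · cases hk : count t w with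
      | zero => exact ⟨0, ht, by omega⟩
      | succ k =>
        have h1 := (mem_slot_count hω t).1
        have h2 := strictMono_arrival w (Nat.lt_succ_self k)
        rw [hk] at h1
        refine ⟨⟨arrival k w, arrival_nonneg k w⟩, ?_, ?_⟩
        · exact NNReal.coe_lt_coe.1 (h2.trans_le h1)
        · exact Nat.succ_le_succ ((le_count_iff hω _ _).2 le_rfl)
    · exact ⟨⟨arrival n w, arrival_nonneg n w⟩, (le_count_iff hω _ _).2 le_rfl⟩

/-! ### The canonical compound Poisson law -/

/-- The law on `Omega` under which the interarrival times are i.i.d. exponential with rate `r`, the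
claim sizes are i.i.d. with law `ν` and independent of the interarrival times, and `Θ = θ`. -/
def cpp (r : Pos) (ν : Measure Pos) [IsProbabilityMeasure ν] (θ : Pos) : Measure Omega :=
  ((iid (expPos r)).prod (iid ν)).prod (Measure.dirac θ)

instance (r : Pos) (ν : Measure Pos) [IsProbabilityMeasure ν] (θ : Pos) :
    IsProbabilityMeasure (cpp r ν θ) := by unfold cpp; infer_instance

lemma fibre_eq_cpp (μ : Measure Pos) [IsProbabilityMeasure μ] (θ : Pos) :
    fibre μ θ = cpp θ μ θ := rfl

section CPP

variable (r : Pos) (ν : Measure Pos) [IsProbabilityMeasure ν] (θ : Pos)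

lemma ae_Θ_cpp : ∀ᵐ ω ∂(cpp r ν θ), Θ ω = θ := by
  have h : (cpp r ν θ).map Θ = Measure.dirac θ := by
    change (cpp r ν θ).map Prod.snd = _
    rw [cpp, Measure.map_snd_prod, measure_univ, one_smul]
  refine ae_of_ae_map (f := Θ) (p := fun x => x = θ) measurable_Θ.aemeasurable ?_
  rw [h]
  exact (ae_dirac_iff (measurableSet_singleton θ)).2 rfl

lemma map_fst_cpp : (cpp r ν θ).map Prod.fst = (iid (expPos r)).prod (iid ν) := by
  rw [cpp, Measure.map_fst_prod, measure_univ, one_smul]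

lemma map_W_cpp : (cpp r ν θ).map (fun ω => ω.1.1) = iid (expPos r) := by
  have h : (fun ω : Omega => ω.1.1) = Prod.fst ∘ Prod.fst := rfl
  rw [h, ← Measure.map_map measurable_fst measurable_fst, map_fst_cpp, Measure.map_fst_prod,
    measure_univ, one_smul]

lemma map_X_cpp : (cpp r ν θ).map (fun ω => ω.1.2) = iid ν := by
  have h : (fun ω : Omega => ω.1.2) = Prod.snd ∘ Prod.fst := rfl
  rw [h, ← Measure.map_map measurable_snd measurable_fst, map_fst_cpp, Measure.map_snd_prod,
    measure_univ, one_smul]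

lemma indepFun_W_X_cpp : IndepFun (fun ω : Omega => ω.1.1) (fun ω => ω.1.2) (cpp r ν θ) := by
  rw [indepFun_iff_map_prod_eq_prod_map_map (by fun_prop) (by fun_prop), map_W_cpp, map_X_cpp]
  exact map_fst_cpp r ν θ

lemma map_comp_W_cpp {β : Type*} [MeasurableSpace β] {φ : (ℕ → Pos) → β} (hφ : Measurable φ) :
    (cpp r ν θ).map (fun ω => φ ω.1.1) = (iid (expPos r)).map φ := by
  rw [← map_W_cpp r ν θ, Measure.map_map hφ (by fun_prop)]
  rfl

lemma ae_nonExplosive_cpp : ∀ᵐ ω ∂(cpp r ν θ), ω.1.1 ∈ nonExplosive := by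
  refine ae_of_ae_map (f := fun ω : Omega => ω.1.1) (p := fun w => w ∈ nonExplosive)
    (by fun_prop) ?_
  rw [map_W_cpp]
  exact ae_nonExplosive r

lemma measurable_incr {n : ℕ} (t : Fin (n + 1) → ℝ≥0) (h : ℝ≥0) : Measurable (incr t h) :=
  (measurable_incrCount fun i => h + t i).comp (measurable_fst.comp measurable_fst)

lemma map_incr_cpp {n : ℕ} {t : Fin (n + 1) → ℝ≥0} (ht : Monotone t) (h : ℝ≥0) :
    (cpp r ν θ).map (incr t h) = Measure.pi fun i => incrLaw r (t i.succ - t i.castSucc) := by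
  have hm : Monotone fun i => h + t i := fun i j hij => by
    simpa using ht hij
  have h1 := map_incrCount_iid r hm
  simp only [add_tsub_add_eq_tsub_left] at h1
  rw [← h1, ← map_comp_W_cpp r ν θ (measurable_incrCount _)]
  rfl

lemma isPoissonProcess_cpp : IsPoissonProcess (cpp r ν θ) r where
  indep n t ht := by
    have hm : ∀ i, Measurable fun ω => incr t 0 ω i := fun i =>
      (measurable_pi_apply i).comp (measurable_incr t 0)
    rw [iIndepFun_iff_map_fun_eq_pi_map fun i => (hm i).aemeasurable]
    have h0 := map_incr_cpp r ν θ ht 0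
    have h1 : ∀ i, (cpp r ν θ).map (fun ω => incr t 0 ω i)
        = incrLaw r (t i.succ - t i.castSucc) := by
      intro i
      have : (fun ω => incr t 0 ω i) = (Function.eval i) ∘ (incr t 0) := rfl
      rw [this, ← Measure.map_map (measurable_pi_apply i) (measurable_incr t 0), h0,
        Measure.pi_map_eval]
      simp
    simp_rw [h1]
    exact h0
  stationary n t ht h := by rw [map_incr_cpp r ν θ ht, map_incr_cpp r ν θ ht]
  poisson t _ := by
    rw [← map_count_iid, ← map_comp_W_cpp r ν θ (measurable_count t)]
    rfl

end CPP

lemma measurable_path_N : Measurable fun (ω : Omega) (t : ℝ≥0) => N t ω :=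
  measurable_pi_lambda _ fun t => measurable_N t

lemma measurable_path_count : Measurable fun (w : ℕ → Pos) (t : ℝ≥0) => count t w :=
  measurable_pi_lambda _ fun t => measurable_count t

/-- A sufficient condition for `(N, X)` being a risk process. -/
lemma isRiskProcess_of_indepFun {Q : Measure Omega} [IsProbabilityMeasure Q] {ν : Measure Pos}
    [IsProbabilityMeasure ν] (hN : ∀ᵐ ω ∂Q, ω.1.1 ∈ nonExplosive)
    (hX : Q.map (fun ω => ω.1.2) = iid ν)
    (hWX : IndepFun (fun ω : Omega => ω.1.1) (fun ω => ω.1.2) Q) : IsRiskProcess Q := by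
  have hXn : ∀ n, Q.map (X n) = ν := by
    intro n
    have : X n = (fun x : ℕ → Pos => x n) ∘ fun ω : Omega => ω.1.2 := rfl
    rw [this, ← Measure.map_map (by fun_prop) (by fun_prop), hX]
    exact Measure.infinitePi_map_eval (fun _ : ℕ => ν) n
  refine ⟨(isCountingProcess_iff Q).2 hN, ?_, fun n => by rw [hXn, hXn], ?_⟩
  · rw [iIndepFun_iff_map_fun_eq_infinitePi_map measurable_X]
    simp_rw [hXn]
    exact hX
  · exact hWX.comp measurable_path_count measurable_id

lemma isCPP_cpp (r : Pos) (ν : Measure Pos) [IsProbabilityMeasure ν] (θ : Pos) :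
    IsCPP (cpp r ν θ) r :=
  ⟨isRiskProcess_of_indepFun (ae_nonExplosive_cpp r ν θ) (map_X_cpp r ν θ)
    (indepFun_W_X_cpp r ν θ), isPoissonProcess_cpp r ν θ⟩

/-! ### Disintegration with respect to the structure parameter -/

/-- `κ` disintegrates `Q` with respect to `Θ`. -/
def Disintegrates (κ : Kernel Pos Omega) (Q : Measure Omega) : Prop :=
  (Q.map Θ) ⊗ₘ κ = Q.map fun ω => (Θ ω, ω)

lemma measurable_graph_Θ : Measurable fun ω : Omega => (Θ ω, ω) :=
  measurable_Θ.prodMk measurable_id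

lemma disintegrates_iff {κ : Kernel Pos Omega} [IsMarkovKernel κ] {Q : Measure Omega}
    [IsProbabilityMeasure Q] :
    Disintegrates κ Q ↔ ∀ B, MeasurableSet B → ∀ D, MeasurableSet D →
      ∫⁻ θ in B, κ θ D ∂(Q.map Θ) = Q (Θ ⁻¹' B ∩ D) := by
  have : IsProbabilityMeasure (Q.map Θ) :=
    Measure.isProbabilityMeasure_map measurable_Θ.aemeasurable
  rw [Disintegrates, Measure.ext_prod_iff]
  refine forall_congr' fun B => ?_
  constructor
  · intro h hB D hD
    have h1 := h hB hD
    rw [Measure.compProd_apply_prod hB hD, Measure.map_apply measurable_graph_Θ (hB.prod hD)] at h1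
    exact h1
  · intro h D hB hD
    rw [Measure.compProd_apply_prod hB hD, Measure.map_apply measurable_graph_Θ (hB.prod hD)]
    exact h hB D hD

section Disintegrates

variable {κ : Kernel Pos Omega} [IsMarkovKernel κ] {Q : Measure Omega} [IsProbabilityMeasure Q]

instance : IsProbabilityMeasure (Q.map Θ) :=
  Measure.isProbabilityMeasure_map measurable_Θ.aemeasurable

lemma disintegrates_condDistrib : Disintegrates (condDistrib id Θ Q) Q :=
  compProd_map_condDistrib aemeasurable_id

/-- Consistency, applied to both `B` and `Bᶜ`, shows that `κ θ` of `Θ ⁻¹' B ∩ D` is `κ θ D` for `θ`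
in `B` and zero otherwise, almost everywhere. -/
lemma IsRCP.disintegrates (h : IsRCP κ Q) : Disintegrates κ Q := by
  rw [disintegrates_iff]
  intro B hB D hD
  rw [← h.lintegral_eq _ ((measurable_Θ hB).inter hD), ← lintegral_indicator hB]
  refine lintegral_congr_ae ?_
  filter_upwards [h.consistent B hB, h.consistent Bᶜ hB.compl] with θ h1 h2
  by_cases hθ : θ ∈ B
  · rw [indicator_of_mem hθ]
    have h3 : κ θ (Θ ⁻¹' B)ᶜ = 0 := (prob_compl_eq_zero_iff (measurable_Θ hB)).2 (h1 hθ)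
    rw [inter_comm]
    exact (measure_inter_conull h3).symm
  · rw [indicator_of_notMem hθ]
    have h3 : κ θ (Θ ⁻¹' Bᶜ)ᶜ = 0 :=
      (prob_compl_eq_zero_iff (measurable_Θ hB.compl)).2 (h2 hθ)
    rw [preimage_compl, compl_compl] at h3
    exact (measure_mono_null inter_subset_left h3).symm

lemma Disintegrates.isRCP (h : Disintegrates κ Q) (hΘ : ∀ θ, ∀ᵐ ω ∂(κ θ), Θ ω = θ) :
    IsRCP κ Q where
  isMarkovKernel := inferInstance
  lintegral_eq D hD := by
    have := disintegrates_iff.1 h univ MeasurableSet.univ D hD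
    rwa [Measure.restrict_univ, preimage_univ, univ_inter] at this
  consistent B hB := by
    refine ae_of_all _ fun θ hθ => ?_
    refine (mem_ae_iff_prob_eq_one (measurable_Θ hB)).1 ?_
    filter_upwards [hΘ θ] with ω hω
    exact mem_preimage.2 (hω ▸ hθ)

lemma Disintegrates.ae_eq {η : Kernel Pos Omega} [IsMarkovKernel η] (h : Disintegrates κ Q)
    (h' : Disintegrates η Q) : ∀ᵐ θ ∂(Q.map Θ), κ θ = η θ :=
  Kernel.ae_eq_of_compProd_eq (Eq.trans h (Eq.symm h'))

lemma Disintegrates.condDistrib_ae_eq (h : Disintegrates κ Q) {β : Type*} [MeasurableSpace β]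
    [StandardBorelSpace β] [Nonempty β] {Y : Omega → β} (hY : Measurable Y) :
    ∀ᵐ θ ∂(Q.map Θ), condDistrib Y Θ Q θ = (κ θ).map Y := by
  have h1 : condDistrib Y Θ Q =ᵐ[Q.map Θ] κ.map Y := by
    have : IsMarkovKernel (κ.map Y) := Kernel.IsMarkovKernel.map _ hY
    refine condDistrib_ae_eq_of_measure_eq_compProd Θ hY.aemeasurable ?_
    rw [Measure.compProd_map hY, h, Measure.map_map (by fun_prop) measurable_graph_Θ]
    rfl
  filter_upwards [h1] with θ hθ
  rw [hθ, Kernel.map_apply _ hY]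

/-- The kernel `κ` as a kernel from `Omega` with the sigma-algebra generated by `Θ`. -/
def compΘ (κ : Kernel Pos Omega) : @Kernel Omega Omega sigmaΘ _ :=
  @Kernel.comap Pos Omega _ _ Omega sigmaΘ κ Θ (comap_measurable Θ)

lemma compΘ_apply (κ : Kernel Pos Omega) (ω : Omega) : compΘ κ ω = κ (Θ ω) := rfl

/-- The bridge between conditional independence given `sigmaΘ`, which is phrased with
`condExpKernel`, and ordinary independence under the fibres `κ θ`. -/
lemma Disintegrates.condExpKernel_ae_eq (h : Disintegrates κ Q) :
    condExpKernel Q sigmaΘ =ᵐ[Q.trim sigmaΘ_le] compΘ κ := by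
  have : @IsMarkovKernel _ _ sigmaΘ _ (compΘ κ) := ⟨fun ω => by
    rw [compΘ_apply]; infer_instance⟩
  refine Kernel.ae_eq_of_compProd_eq ?_
  rw [compProd_trim_condExpKernel]
  refine Measure.ext_prod (mα := sigmaΘ) fun {A D} hA hD => ?_
  obtain ⟨B, hB, rfl⟩ := hA
  have hdiag : @Measurable Omega (Omega × Omega) _ (sigmaΘ.prod Prod.instMeasurableSpace)
      Function.diag :=
    @Measurable.prodMk _ _ _ _ sigmaΘ _ _ _ (measurable_id'' sigmaΘ_le) measurable_id
  have hΘ : @Measurable _ _ sigmaΘ _ Θ := comap_measurable Θ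
  rw [Measure.compProd_apply_prod (hΘ hB) hD,
    Measure.map_apply hdiag (@MeasurableSet.prod _ _ sigmaΘ _ _ _ (hΘ hB) hD)]
  refine Eq.trans ?_ ((disintegrates_iff.1 h B hB D hD).symm.trans ?_)
  · rfl
  · rw [← map_trim_comap measurable_Θ, @setLIntegral_map _ _ sigmaΘ _ (Q.trim sigmaΘ_le) _ _ _ hB
      (κ.measurable_coe hD) hΘ]
    rfl

lemma Disintegrates.apply (h : Disintegrates κ Q) {D : Set Omega} (hD : MeasurableSet D) :
    ∫⁻ θ, κ θ D ∂(Q.map Θ) = Q D := by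
  have := disintegrates_iff.1 h univ MeasurableSet.univ D hD
  rwa [Measure.restrict_univ, preimage_univ, univ_inter] at this

end Disintegrates

/-! ### Mixtures of compound Poisson laws -/

section Mixture

variable {κ : Kernel Pos Omega} [IsMarkovKernel κ] {Q : Measure Omega} [IsProbabilityMeasure Q]
  {g : Pos → Pos} {ν : Measure Pos} [IsProbabilityMeasure ν]

lemma Disintegrates.ae_nonExplosive (h : Disintegrates κ Q) (hκ : ∀ θ, κ θ = cpp (g θ) ν θ) :
    ∀ᵐ ω ∂Q, ω.1.1 ∈ nonExplosive := by
  have hm : MeasurableSet {ω : Omega | ω.1.1 ∈ nonExplosive}ᶜ :=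
    (measurableSet_nonExplosive.preimage (measurable_fst.comp measurable_fst)).compl
  have h0 : ∀ θ, κ θ {ω : Omega | ω.1.1 ∈ nonExplosive}ᶜ = 0 := fun θ => by
    rw [hκ]
    exact ae_nonExplosive_cpp (g θ) ν θ
  have h1 := h.apply hm
  simp_rw [h0, lintegral_zero] at h1
  exact h1.symm

lemma Disintegrates.map_X (h : Disintegrates κ Q) (hκ : ∀ θ, κ θ = cpp (g θ) ν θ) :
    Q.map (fun ω => ω.1.2) = iid ν := by
  have hm : Measurable fun ω : Omega => ω.1.2 := by fun_prop
  ext C hC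
  have h0 : ∀ θ, κ θ ((fun ω : Omega => ω.1.2) ⁻¹' C) = iid ν C := fun θ => by
    rw [hκ, ← Measure.map_apply hm hC, map_X_cpp]
  rw [Measure.map_apply hm hC, ← h.apply (hm hC)]
  simp_rw [h0]
  simp

/-- In each fibre `Θ` is constant, so `A` may be replaced by its section at `θ` and the claims split
off. Their law does not depend on `θ`, so the factor survives integration. -/
lemma Disintegrates.indepFun_WΘ_X (h : Disintegrates κ Q) (hκ : ∀ θ, κ θ = cpp (g θ) ν θ) :
    IndepFun (fun ω : Omega => (ω.1.1, Θ ω)) (fun ω => ω.1.2) Q := by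
  have hm : Measurable fun ω : Omega => ω.1.2 := by fun_prop
  have hmW : Measurable fun ω : Omega => (ω.1.1, Θ ω) :=
    (measurable_fst.comp measurable_fst).prodMk measurable_Θ
  rw [indepFun_iff_measure_inter_preimage_eq_mul]
  intro A C hA hC
  have h0 : ∀ θ, κ θ ((fun ω : Omega => (ω.1.1, Θ ω)) ⁻¹' A ∩ (fun ω => ω.1.2) ⁻¹' C)
      = κ θ ((fun ω : Omega => (ω.1.1, Θ ω)) ⁻¹' A) * iid ν C := fun θ => by
    have hA' : MeasurableSet ((fun w => (w, θ)) ⁻¹' A) :=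
      (measurable_id.prodMk measurable_const) hA
    have h1 : ∀ᵐ ω ∂(κ θ), (ω ∈ (fun ω : Omega => (ω.1.1, Θ ω)) ⁻¹' A) =
        (ω ∈ (fun ω : Omega => ω.1.1) ⁻¹' ((fun w => (w, θ)) ⁻¹' A)) := by
      rw [hκ]
      filter_upwards [ae_Θ_cpp (g θ) ν θ] with ω hω
      simp only [mem_preimage, hω]
    have h2 : (fun ω : Omega => (ω.1.1, Θ ω)) ⁻¹' A =ᵐ[κ θ]
      (fun ω : Omega => ω.1.1) ⁻¹' ((fun w => (w, θ)) ⁻¹' A) := h1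
    have h3 : κ θ ((fun ω : Omega => (ω.1.1, Θ ω)) ⁻¹' A ∩ (fun ω => ω.1.2) ⁻¹' C)
        = κ θ ((fun ω : Omega => ω.1.1) ⁻¹' ((fun w => (w, θ)) ⁻¹' A) ∩ (fun ω => ω.1.2) ⁻¹' C) :=
      measure_congr (h2.inter (ae_eq_refl _))
    rw [measure_congr h2, h3, hκ,
      (indepFun_W_X_cpp (g θ) ν θ).measure_inter_preimage_eq_mul _ _ hA' hC,
      ← Measure.map_apply hm hC, map_X_cpp]
  rw [← h.apply ((hmW hA).inter (hm hC)), ← h.apply (hmW hA), ← Measure.map_apply hm hC,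
    h.map_X hκ]
  simp_rw [h0]
  rw [lintegral_mul_const _ (κ.measurable_coe (hmW hA))]

lemma Disintegrates.condA1 (h : Disintegrates κ Q) (hκ : ∀ θ, κ θ = cpp (g θ) ν θ) :
    CondA1 Q := by
  refine Kernel.IndepFun.congr h.condExpKernel_ae_eq.symm ?_
  rw [Kernel.indepFun_iff_measure_inter_preimage_eq_mul]
  intro A C hA hC
  refine ae_of_all _ fun ω => ?_
  rw [compΘ_apply, hκ]
  exact (indepFun_W_X_cpp (g (Θ ω)) ν (Θ ω)).measure_inter_preimage_eq_mul _ _ hA hC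

lemma Disintegrates.condA2 (h : Disintegrates κ Q) (hκ : ∀ θ, κ θ = cpp (g θ) ν θ) :
    CondA2 Q :=
  (h.indepFun_WΘ_X hκ).comp measurable_snd measurable_id

lemma Disintegrates.isCMPP (h : Disintegrates κ Q) (hκ : ∀ θ, κ θ = cpp (g θ) ν θ) :
    IsCMPP Q g := by
  refine ⟨isRiskProcess_of_indepFun (h.ae_nonExplosive hκ) (h.map_X hκ)
    ((h.indepFun_WΘ_X hκ).comp measurable_fst measurable_id), ?_, ?_, ?_⟩
  · intro n t ht
    refine Kernel.iIndepFun.congr h.condExpKernel_ae_eq.symm ?_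
    rw [Kernel.iIndepFun_iff_measure_inter_preimage_eq_mul]
    intro I A hA
    refine ae_of_all _ fun ω => ?_
    rw [compΘ_apply, hκ]
    exact ((isPoissonProcess_cpp (g (Θ ω)) ν (Θ ω)).indep n t ht).measure_inter_preimage_eq_mul
      I hA
  · intro n t ht s
    filter_upwards [h.condDistrib_ae_eq (measurable_incr t s),
      h.condDistrib_ae_eq (measurable_incr t 0)] with θ h1 h2
    rw [h1, h2, hκ, (isPoissonProcess_cpp (g θ) ν θ).stationary n t ht]
  · intro t ht
    filter_upwards [h.condDistrib_ae_eq (measurable_N t)] with θ h1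
    rw [h1, hκ, (isPoissonProcess_cpp (g θ) ν θ).poisson t ht]

end Mixture

/-! ### Events of the filtration -/

lemma measurable_S_F {u t : ℝ≥0} (h : u ≤ t) : Measurable[F t] (S u) := by
  refine measurable_iff_comap_le.2 (le_sup_of_le_left ?_)
  exact le_iSup₂ (f := fun (u : ℝ≥0) (_ : u ≤ t) =>
    MeasurableSpace.comap (S u) Real.measurableSpace) u h

lemma measurable_Θ_F (t : ℝ≥0) : Measurable[F t] Θ :=
  measurable_iff_comap_le.2 le_sup_right

/-- Events of `F t` only depend on the structure parameter and the path of `S` up to time `t`. -/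
lemma mem_of_measurableSet_F {t : ℝ≥0} {A : Set Omega} (hA : MeasurableSet[F t] A) {ω ω' : Omega}
    (hΘ : Θ ω = Θ ω') (hS : ∀ u ≤ t, S u ω = S u ω') (hω : ω ∈ A) : ω' ∈ A := by
  let Ψ : Omega → (Iic t → ℝ) × Pos := fun ω => (fun u => S u ω, Θ ω)
  have hle : (F t : MeasurableSpace Omega) ≤ MeasurableSpace.comap Ψ inferInstance := by
    have hΨ : Measurable[MeasurableSpace.comap Ψ inferInstance] Ψ := comap_measurable Ψ
    refine sup_le (iSup₂_le fun u hu => ?_) ?_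
    · have : S u = fun ω => (Ψ ω).1 ⟨u, hu⟩ := rfl
      rw [this]
      exact (((measurable_pi_apply _).comp measurable_fst).comp hΨ).comap_le
    · exact (measurable_snd.comp hΨ).comap_le
  obtain ⟨B, -, rfl⟩ := hle A hA
  have : Ψ ω = Ψ ω' := Prod.ext (funext fun u => hS u u.2) hΘ
  exact mem_preimage.2 (this ▸ hω)

lemma count_le_of_mem_slot {m : ℕ} {t u : ℝ≥0} (hu : u ≤ t) {w : ℕ → Pos} (hw : w ∈ slot m t) :
    count u w ≤ m := by
  have hu' : (u : ℝ) ≤ t := by exact_mod_cast hu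
  have h1 := (mem_slot_count_of_lt (hu'.trans_lt hw.2)).1
  by_contra hc
  have h2 := monotone_arrival w (show m + 1 ≤ count u w by omega)
  linarith [hw.2]

/-- Interarrival times beyond the first `m` only matter through the next arrival falling after `t`,
which the slot already guarantees. This makes events of `F t` finite dimensional on each slot. -/
lemma count_congr {m : ℕ} {t u : ℝ≥0} (hu : u ≤ t) {w w' : ℕ → Pos} (hw : w ∈ slot m t)
    (hw' : w' ∈ slot m t) (h : ∀ i < m, w i = w' i) : count u w = count u w' := by
  have hu' : (u : ℝ) ≤ t := by exact_mod_cast hu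
  have harr : ∀ n ≤ m, arrival n w = arrival n w' := fun n hn => by
    rw [arrival_eq, arrival_eq]
    exact Finset.sum_congr rfl fun i hi => by rw [h i ((Finset.mem_range.1 hi).trans_le hn)]
  have h1 := mem_slot_count_of_lt (hu'.trans_lt hw.2)
  have h2 := count_le_of_mem_slot hu hw
  refine (count_of_mem_slot ⟨?_, ?_⟩).symm
  · rw [← harr _ h2]
    exact h1.1
  · rcases h2.eq_or_lt with h3 | h3
    · rw [h3]
      exact hu'.trans_lt hw'.2
    · rw [← harr _ h3]
      exact h1.2

/-! ### Change of measure on `F t` for compound Poisson laws -/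

lemma cpp_apply (r : Pos) (ν : Measure Pos) [IsProbabilityMeasure ν] (θ : Pos) {A : Set Omega}
    (hA : MeasurableSet A) :
    cpp r ν θ A = ((iid (expPos r)).prod (iid ν)) ((fun p => (p, θ)) ⁻¹' A) := by
  rw [cpp, Measure.prod_dirac, Measure.map_apply (by fun_prop) hA]

lemma lintegral_cpp (r : Pos) (ν : Measure Pos) [IsProbabilityMeasure ν] (θ : Pos)
    {G : Omega → ℝ≥0∞} (hG : Measurable G) :
    ∫⁻ ω, G ω ∂(cpp r ν θ) = ∫⁻ p, G (p, θ) ∂((iid (expPos r)).prod (iid ν)) := by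
  rw [cpp, Measure.prod_dirac, lintegral_map hG (by fun_prop)]

/-- Change of measure on the event of exactly `m` arrivals. -/
lemma prod_iid_slot_apply (r θ : Pos) {μ ν : Measure Pos} [IsProbabilityMeasure μ]
    [IsProbabilityMeasure ν] {f : Pos → ℝ≥0∞} (hf : Measurable f) (hν : ν = μ.withDensity f)
    (m : ℕ) (t : ℝ) {D : Set ((ℕ → Pos) × (ℕ → Pos))} (hD : MeasurableSet D)
    (hW : ∀ x w w', w ∈ slot m t → w' ∈ slot m t → (∀ i < m, w i = w' i) →
      (w, x) ∈ D → (w', x) ∈ D)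
    (hX : ∀ w ∈ slot m t, ∀ x x', (∀ i < m, x i = x' i) → (w, x) ∈ D → (w, x') ∈ D) :
    ((iid (expPos r)).prod (iid ν)) (Prod.fst ⁻¹' slot m t ∩ D)
      = ∫⁻ p in Prod.fst ⁻¹' slot m t ∩ D,
          ENNReal.ofReal ((r / θ) ^ m * Real.exp (-((r - θ) * t)))
            * ∏ i ∈ Finset.range m, f (p.2 i) ∂((iid (expPos θ)).prod (iid μ)) := by
  have hE : MeasurableSet (Prod.fst ⁻¹' slot m t ∩ D) :=
    (measurable_fst (measurableSet_slot m t)).inter hD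
  have hprod : Measurable fun x : ℕ → Pos => ∏ i ∈ Finset.range m, f (x i) :=
    Finset.measurable_fun_prod _ fun i _ => hf.comp (measurable_pi_apply i)
  set G : (ℕ → Pos) × (ℕ → Pos) → ℝ≥0∞ :=
    (Prod.fst ⁻¹' slot m t ∩ D).indicator fun p => ∏ i ∈ Finset.range m, f (p.2 i) with hGdef
  have hG : Measurable G := (hprod.comp measurable_snd).indicator hE
  -- The claim law is changed first, with the interarrival times fixed.
  have h1 : ((iid (expPos r)).prod (iid ν)) (Prod.fst ⁻¹' slot m t ∩ D)
      = ∫⁻ p, G p ∂((iid (expPos r)).prod (iid μ)) := by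
    rw [Measure.prod_apply hE, lintegral_prod _ hG.aemeasurable]
    refine lintegral_congr fun w => ?_
    by_cases hw : w ∈ slot m t
    · have hs : Prod.mk w ⁻¹' (Prod.fst ⁻¹' slot m t ∩ D) = Prod.mk w ⁻¹' D := by
        ext x
        simp [hw]
      have hms : MeasurableSet (Prod.mk w ⁻¹' D) := measurable_prodMk_left hD
      rw [hs, iid_withDensity_apply μ ν hf hν m _ hms fun x x' h hx => hX w hw x x' h hx,
        ← lintegral_indicator hms]
      refine lintegral_congr fun x => ?_
      by_cases hx : (w, x) ∈ D
      · rw [hGdef, indicator_of_mem (show (w, x) ∈ Prod.fst ⁻¹' slot m t ∩ D from ⟨hw, hx⟩),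
          indicator_of_mem (by exact hx)]
      · rw [hGdef, indicator_of_notMem (show (w, x) ∉ Prod.fst ⁻¹' slot m t ∩ D from
          fun h => hx h.2), indicator_of_notMem (by exact hx)]
    · have hs : Prod.mk w ⁻¹' (Prod.fst ⁻¹' slot m t ∩ D) = ∅ := by
        ext x
        simp [hw]
      rw [hs, measure_empty]
      refine ((lintegral_congr fun x => ?_).trans lintegral_zero).symm
      rw [hGdef, indicator_of_notMem fun h => hw h.1]
  -- Fubini in the other order, with the claims fixed, prepares the change of rate by
  -- `iid_expPos_slot_inter`.
  have h2 : ∀ s : Pos, ∫⁻ p, G p ∂((iid (expPos s)).prod (iid μ))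
      = ∫⁻ x, (∏ i ∈ Finset.range m, f (x i))
        * iid (expPos s) (slot m t ∩ (fun w => (w, x)) ⁻¹' D) ∂(iid μ) := by
    intro s
    rw [lintegral_prod_symm _ hG.aemeasurable]
    refine lintegral_congr fun x => ?_
    have hms : MeasurableSet (slot m t ∩ (fun w => (w, x)) ⁻¹' D) :=
      (measurableSet_slot m t).inter (measurable_prodMk_right hD)
    rw [← lintegral_indicator_one hms, ← lintegral_const_mul _ (measurable_one.indicator hms)]
    refine lintegral_congr fun w => ?_
    by_cases hw : w ∈ slot m t ∩ (fun w => (w, x)) ⁻¹' D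
    · rw [hGdef, indicator_of_mem (by exact hw), indicator_of_mem hw, Pi.one_apply, mul_one]
    · rw [hGdef, indicator_of_notMem (by exact hw), indicator_of_notMem hw, mul_zero]
  have hmeas : Measurable fun x => (∏ i ∈ Finset.range m, f (x i))
        * iid (expPos θ) (slot m t ∩ (fun w => (w, x)) ⁻¹' D) :=
    hprod.mul (measurable_measure_prodMk_right hE)
  rw [h1, h2, ← lintegral_indicator hE]
  have h3 : ∀ p : (ℕ → Pos) × (ℕ → Pos), (Prod.fst ⁻¹' slot m t ∩ D).indicator (fun p =>
      ENNReal.ofReal ((r / θ) ^ m * Real.exp (-((r - θ) * t)))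
        * ∏ i ∈ Finset.range m, f (p.2 i)) p
      = ENNReal.ofReal ((r / θ) ^ m * Real.exp (-((r - θ) * t))) * G p := by
    intro p
    by_cases hp : p ∈ Prod.fst ⁻¹' slot m t ∩ D
    · rw [hGdef, indicator_of_mem hp, indicator_of_mem hp]
    · rw [hGdef, indicator_of_notMem hp, indicator_of_notMem hp, mul_zero]
  simp_rw [h3]
  rw [lintegral_const_mul _ hG, h2, ← lintegral_const_mul _ hmeas]
  refine lintegral_congr fun x => ?_
  rw [iid_expPos_slot_inter r θ m t _ (measurable_prodMk_right hD) fun w w' => hW x w w']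
  ring

/-- Separates the rate density from the claim density: since `r / θ = exp (α θ)`, the `α` part of
the exponent becomes the power. -/
lemma ofReal_MTilde {β : Pos → Pos → ℝ} {α γ : Pos → ℝ} (hβ : ∀ x θ, β x θ = α θ + γ x)
    {r θ : Pos} (hr : (r : ℝ) = θ * Real.exp (α θ)) (t : ℝ≥0) (ω : Omega) :
    ENNReal.ofReal (MTilde β α θ t ω)
      = ENNReal.ofReal ((r / θ) ^ N t ω * Real.exp (-((r - θ) * t)))
        * ∏ i ∈ Finset.range (N t ω), ENNReal.ofReal (Real.exp (γ (X i ω))) := by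
  have hθ : (θ : ℝ) ≠ 0 := ne_of_gt θ.2
  rw [← ENNReal.ofReal_prod_of_nonneg fun i _ => (Real.exp_pos _).le,
    ← ENNReal.ofReal_mul (mul_nonneg (pow_nonneg (div_nonneg r.2.le θ.2.le) _) (Real.exp_pos _).le),
    hr, mul_div_cancel_left₀ _ hθ, ← Real.exp_nat_mul, ← Real.exp_sum, ← Real.exp_add,
    ← Real.exp_add, MTilde]
  congr 2
  simp_rw [hβ]
  rw [Finset.sum_add_distrib, Finset.sum_const, Finset.card_range, nsmul_eq_mul]
  ring

lemma measurable_sum_X {γ : Pos → ℝ} (hγ : Measurable γ) (t : ℝ≥0) :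
    Measurable fun ω => ∑ k ∈ Finset.range (N t ω), γ (X k ω) := by
  have h1 : Measurable (Function.uncurry fun (n : ℕ) (ω : Omega) =>
      ∑ k ∈ Finset.range n, γ (X k ω)) :=
    measurable_from_prod_countable_right fun n => by
      change Measurable fun ω => ∑ k ∈ Finset.range n, γ (X k ω)
      exact Finset.measurable_fun_sum _ fun k _ => hγ.comp (measurable_X k)
  have h2 : Measurable fun ω => (N t ω, ω) := (measurable_N t).prodMk measurable_id
  exact h1.comp h2

/-- The count is written as a sum of ones over the claims, so that one measurability lemma for claim
sums covers both terms. -/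
lemma MTilde_eq {β : Pos → Pos → ℝ} {α γ : Pos → ℝ} (hβ : ∀ x θ, β x θ = α θ + γ x) (θ : Pos)
    (t : ℝ≥0) (ω : Omega) :
    MTilde β α θ t ω = Real.exp (((∑ k ∈ Finset.range (N t ω), (fun _ => (1 : ℝ)) (X k ω)) * α θ
      + ∑ k ∈ Finset.range (N t ω), γ (X k ω)) - t * θ * (Real.exp (α θ) - 1)) := by
  rw [MTilde]
  simp_rw [hβ]
  rw [Finset.sum_add_distrib, Finset.sum_const, Finset.sum_const, nsmul_eq_mul, nsmul_eq_mul,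
    mul_one]

lemma measurable_MTilde {β : Pos → Pos → ℝ} {α γ : Pos → ℝ} (hβ : ∀ x θ, β x θ = α θ + γ x)
    (hγ : Measurable γ) (θ : Pos) (t : ℝ≥0) : Measurable (MTilde β α θ t) := by
  have h1 := measurable_sum_X (γ := fun _ => 1) measurable_const t
  have h2 := measurable_sum_X hγ t
  have : MTilde β α θ t = _ := funext (MTilde_eq hβ θ t)
  rw [this]
  exact Real.measurable_exp.comp (((h1.mul_const _).add h2).sub_const _)

/-- The density of one compound Poisson law with respect to another on `F t`. -/
lemma cpp_apply_eq_lintegral {β : Pos → Pos → ℝ} {α γ : Pos → ℝ}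
    (hβ : ∀ x θ, β x θ = α θ + γ x) (hγ : Measurable γ) {r θ : Pos}
    (hr : (r : ℝ) = θ * Real.exp (α θ)) {μ ν : Measure Pos} [IsProbabilityMeasure μ]
    [IsProbabilityMeasure ν] (hν : ν = μ.withDensity fun x => ENNReal.ofReal (Real.exp (γ x)))
    (t : ℝ≥0) {A : Set Omega} (hA : MeasurableSet[F t] A) :
    cpp r ν θ A = ∫⁻ ω in A, ENNReal.ofReal (MTilde β α θ t ω) ∂(cpp θ μ θ) := by
  have hA' : MeasurableSet A := F.le t A hA
  have hM := (measurable_MTilde hβ hγ θ t).ennreal_ofReal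
  set D : Set ((ℕ → Pos) × (ℕ → Pos)) := (fun p => (p, θ)) ⁻¹' A with hD
  have hDm : MeasurableSet D := (measurable_id.prodMk measurable_const) hA'
  have hE : ∀ m, MeasurableSet (Prod.fst ⁻¹' slot m t ∩ D) := fun m =>
    (measurable_fst (measurableSet_slot m t)).inter hDm
  have hdisj : Pairwise (Function.onFun Disjoint fun m => Prod.fst ⁻¹' slot m t ∩ D) :=
    fun k l hkl => Set.disjoint_left.2 fun p hk hl => hkl (slot_unique hk.1 hl.1)
  -- Off the explosive sequences the slots partition the space, under either law.
  have hae : ∀ (r : Pos) (ν : Measure Pos) [IsProbabilityMeasure ν],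
      D =ᵐ[(iid (expPos r)).prod (iid ν)] ⋃ m, Prod.fst ⁻¹' slot m t ∩ D := by
    intro r ν _
    have h : ∀ᵐ p ∂((iid (expPos r)).prod (iid ν)), p.1 ∈ nonExplosive := by
      refine ae_of_ae_map (f := Prod.fst) (p := fun w => w ∈ nonExplosive) (by fun_prop) ?_
      rw [Measure.map_fst_prod, measure_univ, one_smul]
      exact ae_nonExplosive r
    filter_upwards [h] with p hp
    refine propext ⟨fun h => mem_iUnion.2 ⟨count t p.1, mem_slot_count hp t, h⟩, fun h => ?_⟩
    obtain ⟨m, hm⟩ := mem_iUnion.1 h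
    exact hm.2
  rw [cpp_apply r ν θ hA', ← lintegral_indicator hA', lintegral_cpp _ _ _ (hM.indicator hA')]
  have hind : ∀ p, A.indicator (fun ω => ENNReal.ofReal (MTilde β α θ t ω)) (p, θ)
      = D.indicator (fun p => ENNReal.ofReal (MTilde β α θ t (p, θ))) p := fun p => rfl
  simp_rw [hind]
  rw [lintegral_indicator hDm, setLIntegral_congr (hae θ μ), lintegral_iUnion hE hdisj,
    measure_congr (hae r ν), measure_iUnion hdisj hE]
  congr 1
  ext m
  rw [prod_iid_slot_apply r θ (by fun_prop) hν m t hDm]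
  · refine setLIntegral_congr_fun (hE m) fun p hp => ?_
    have hN : N t (p, θ) = m := count_of_mem_slot hp.1
    rw [ofReal_MTilde hβ hr, hN]
    rfl
  · intro x w w' hw hw' h hwx
    refine mem_of_measurableSet_F hA (ω := ((w, x), θ)) rfl (fun u hu => ?_) hwx
    rw [S, S, N_eq_count, N_eq_count, count_congr hu hw hw' h]
    rfl
  · intro w hw x x' h hwx
    refine mem_of_measurableSet_F hA (ω := ((w, x), θ)) rfl (fun u hu => ?_) hwx
    rw [S, S]
    refine Finset.sum_congr rfl fun k hk => ?_
    have h1 := (Finset.mem_range.1 hk).trans_le (count_le_of_mem_slot hu hw)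
    exact congrArg _ (h k h1)

/-! ### Adaptedness of the density processes -/

/-- Strict positivity of the claims makes "no counted arrival", which includes explosion, an event
of `S`. -/
lemma S_eq_zero_iff (t : ℝ≥0) (ω : Omega) : S t ω = 0 ↔ N t ω = 0 := by
  constructor
  · intro h
    by_contra hc
    have : 0 < S t ω := Finset.sum_pos (fun k _ => (X k ω).2)
      (Finset.nonempty_range_iff.2 hc)
    exact this.ne' h
  · intro h
    simp [S, h]

/-- Two times whose distance is at most the minimal interarrival time enclose at most one
arrival. -/
lemma count_eq_or_eq_succ {m : ℕ} {t u v : ℝ≥0} {w : ℕ → Pos} (hw : w ∈ slot m t)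
    (huv : u ≤ v) (hv : v ≤ t) (hgap : ∀ k < m, (v : ℝ) - u < w k) :
    count v w = count u w ∨ count v w = count u w + 1 := by
  have huv' : (u : ℝ) ≤ v := by exact_mod_cast huv
  have hvt : (v : ℝ) ≤ t := by exact_mod_cast hv
  have h1 := mem_slot_count_of_lt (hvt.trans_lt hw.2)
  have h2 := mem_slot_count_of_lt ((huv'.trans hvt).trans_lt hw.2)
  have h3 := count_le_of_mem_slot hv hw
  have h4 : count u w ≤ count v w := by
    by_contra hc
    have := monotone_arrival w (show count v w + 1 ≤ count u w by omega)
    linarith [h1.2, h2.1]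
  by_contra hc
  have h5 : count u w + 1 < m := by omega
  have h6 := monotone_arrival w (show count u w + 1 + 1 ≤ count v w by omega)
  have h7 : arrival (count u w + 1 + 1) w = arrival (count u w + 1) w + w (count u w + 1) :=
    Finset.sum_range_succ _ _
  linarith [hgap _ h5, h1.1, h2.2]

/-- The `i`-th point of the partition of `[0, t]` into `n + 1` intervals of equal length. -/
def gridPoint (t : ℝ≥0) (n i : ℕ) : ℝ≥0 := t * (i / (n + 1))

lemma gridPoint_le (t : ℝ≥0) {n i : ℕ} (hi : i ≤ n + 1) : gridPoint t n i ≤ t := by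
  refine mul_le_of_le_one_right (zero_le) (div_le_one_of_le₀ ?_ (zero_le))
  exact_mod_cast hi

lemma gridPoint_mono (t : ℝ≥0) (n : ℕ) {i j : ℕ} (hij : i ≤ j) :
    gridPoint t n i ≤ gridPoint t n j := by
  unfold gridPoint
  gcongr

lemma gridPoint_last (t : ℝ≥0) (n : ℕ) : gridPoint t n (n + 1) = t := by
  unfold gridPoint
  push_cast
  rw [div_self (by positivity), mul_one]

lemma gridPoint_succ_sub (t : ℝ≥0) (n i : ℕ) :
    (gridPoint t n (i + 1) : ℝ) - gridPoint t n i = t / (n + 1) := by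
  unfold gridPoint
  push_cast
  ring

/-- The sum of `h` over the increments of `S` along a partition of `[0, t]`. -/
def gridSum (h : ℝ → ℝ) (t : ℝ≥0) (n : ℕ) (ω : Omega) : ℝ :=
  ∑ i ∈ Finset.range (n + 1), h (S (gridPoint t n (i + 1)) ω - S (gridPoint t n i) ω)

lemma count_zero (w : ℕ → Pos) : count 0 w = 0 := by
  refine count_of_mem_slot ⟨by simp, ?_⟩
  have := strictMono_arrival w (show 0 < 0 + 1 by norm_num)
  simpa using this

lemma N_zero (ω : Omega) : N 0 ω = 0 := count_zero _

/-- Once the mesh is below the first `m` interarrival times, each grid interval contains at most one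
arrival. The increment of `S` is then zero or a single claim, and the sum telescopes. -/
lemma gridSum_eq {h : ℝ → ℝ} (h0 : h 0 = 0) {m : ℕ} {t : ℝ≥0} {ω : Omega}
    (hω : ω.1.1 ∈ slot m t) {n : ℕ} (hgap : ∀ k < m, (t : ℝ) / (n + 1) < ω.1.1 k) :
    gridSum h t n ω = ∑ k ∈ Finset.range (N t ω), h (X k ω) := by
  have hstep : ∀ i ∈ Finset.range (n + 1),
      h (S (gridPoint t n (i + 1)) ω - S (gridPoint t n i) ω)
        = (∑ k ∈ Finset.range (N (gridPoint t n (i + 1)) ω), h (X k ω))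
          - ∑ k ∈ Finset.range (N (gridPoint t n i) ω), h (X k ω) := by
    intro i hi
    have hi' := Finset.mem_range.1 hi
    rcases count_eq_or_eq_succ hω (gridPoint_mono t n (Nat.le_succ i))
      (gridPoint_le t (n := n) (i := i + 1) (by omega))
      (fun k hk => (gridPoint_succ_sub t n i).symm ▸ hgap k hk) with hc | hc
    · rw [S, S, N_eq_count, hc, ← N_eq_count, sub_self, sub_self, h0]
    · rw [S, S, N_eq_count, hc, ← N_eq_count, Finset.sum_range_succ, Finset.sum_range_succ,
        add_sub_cancel_left, add_sub_cancel_left]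
  rw [gridSum, Finset.sum_congr rfl hstep, Finset.sum_range_sub (fun i =>
    ∑ k ∈ Finset.range (N (gridPoint t n i) ω), h (X k ω)), gridPoint_last]
  have : gridPoint t n 0 = 0 := by simp [gridPoint]
  rw [this, N_zero]
  simp

lemma tendsto_gridSum {h : ℝ → ℝ} (h0 : h 0 = 0) {m : ℕ} {t : ℝ≥0} {ω : Omega}
    (hω : ω.1.1 ∈ slot m t) :
    Tendsto (fun n => gridSum h t n ω) atTop
      (nhds (∑ k ∈ Finset.range (N t ω), h (X k ω))) := by
  have hlim : Tendsto (fun n : ℕ => (t : ℝ) / (n + 1)) atTop (nhds 0) := by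
    have := tendsto_one_div_add_atTop_nhds_zero_nat (𝕜 := ℝ) |>.const_mul (t : ℝ)
    simpa [div_eq_mul_inv] using this
  have hev : ∀ᶠ n : ℕ in atTop, ∀ k ∈ Finset.range m, (t : ℝ) / (n + 1) < ω.1.1 k :=
    (eventually_all_finset _).2 fun k _ => hlim.eventually_lt_const (ω.1.1 k).2
  refine tendsto_const_nhds.congr' ?_
  filter_upwards [hev] with n hn
  exact (gridSum_eq h0 hω fun k hk => hn k (Finset.mem_range.2 hk)).symm

lemma measurable_gridSum {h : ℝ → ℝ} (hh : Measurable h) (t : ℝ≥0) (n : ℕ) :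
    Measurable[F t] (gridSum h t n) := by
  have h1 : ∀ i ∈ Finset.range (n + 1), Measurable[F t] fun ω =>
      h (S (gridPoint t n (i + 1)) ω - S (gridPoint t n i) ω) := by
    intro i hi
    have hi' := Finset.mem_range.1 hi
    have h2 := measurable_S_F (gridPoint_le t (n := n) (i := i + 1) (by omega))
    have h3 := measurable_S_F (gridPoint_le t (n := n) (i := i) (by omega))
    exact hh.comp (h2.sub h3)
  exact @Finset.measurable_fun_sum _ _ _ _ _ _ (F t) _ _ h1

/-- The claim sum is a pointwise limit of sums over increments of `S`, which are visible in `F t`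
although `N` and `X` do not generate it. -/
lemma measurable_sum_X_F {γ : Pos → ℝ} (hγ : Measurable γ) (t : ℝ≥0) :
    Measurable[F t] fun ω => ∑ k ∈ Finset.range (N t ω), γ (X k ω) := by
  -- Extension by zero gives `h 0 = 0`, so grid intervals without arrival contribute nothing.
  set h : ℝ → ℝ := Function.extend Subtype.val γ 0 with hdef
  have hh : Measurable h :=
    (MeasurableEmbedding.subtype_coe measurableSet_Ioi).measurable_extend hγ measurable_const
  have h0 : h 0 = 0 := Function.extend_apply' _ _ _ fun ⟨a, ha⟩ => a.2.ne' ha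
  have hX : ∀ a : Pos, h a = γ a := fun a => Subtype.val_injective.extend_apply _ _ _
  have hS : MeasurableSet[F t] {ω | S t ω = 0} :=
    measurable_S_F le_rfl (measurableSet_singleton 0)
  -- The limit is needed for every `ω`, not only almost surely; the indicator removes the exploding
  -- paths, whose claim sum is empty.
  have hG : ∀ n, Measurable[F t] ({ω | S t ω = 0}ᶜ.indicator (gridSum h t n)) := fun n =>
    (measurable_gridSum hh t n).indicator hS.compl
  refine @measurable_of_tendsto_metrizable _ _ (F t) _ _ _ _ _ _ hG ?_
  refine tendsto_pi_nhds.2 fun ω => ?_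
  by_cases hω : S t ω = 0
  · have hN := (S_eq_zero_iff t ω).1 hω
    simp [indicator_of_notMem (show ω ∉ {ω | S t ω = 0}ᶜ from fun h => h hω), hN]
  · obtain ⟨m, hm⟩ := Nat.exists_eq_succ_of_ne_zero (mt (S_eq_zero_iff t ω).2 hω)
    have h1 : ω.1.1 ∈ slot (m + 1) t := mem_slot_of_count_eq_succ hm
    have h2 := tendsto_gridSum h0 h1
    simp_rw [hX] at h2
    simpa only [indicator_of_mem (show ω ∈ {ω | S t ω = 0}ᶜ from hω)] using h2

lemma measurable_MTilde_F {β : Pos → Pos → ℝ} {α γ : Pos → ℝ} (hβ : ∀ x θ, β x θ = α θ + γ x)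
    (hα : Measurable α) (hγ : Measurable γ) (t : ℝ≥0) {τ : Omega → Pos}
    (hτ : Measurable[F t] τ) : Measurable[F t] fun ω => MTilde β α (τ ω) t ω := by
  have h1 := measurable_sum_X_F (γ := fun _ => 1) measurable_const t
  have h2 := measurable_sum_X_F hγ t
  have hα' : Measurable[F t] fun ω => α (τ ω) := hα.comp hτ
  have hτ' : Measurable[F t] fun ω => (τ ω : ℝ) := measurable_subtype_coe.comp hτ
  simp_rw [MTilde_eq hβ]
  generalize (F t : MeasurableSpace Omega) = mF at *
  exact Real.measurable_exp.comp (((h1.mul hα').add h2).sub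
    ((measurable_const.mul hτ').mul ((Real.measurable_exp.comp hα').sub_const _)))

/-! ### Density processes -/

/-- `Z` is a family of nonnegative densities of `Q` with respect to `P` on the sigma-algebras
`F t`. -/
structure IsDensityFamily (Q P : Measure Omega) (Z : ℝ≥0 → Omega → ℝ) : Prop where
  adapted : ∀ t, Measurable[F t] (Z t)
  pos : ∀ t, ∀ᵐ ω ∂P, 0 < Z t ω
  apply_eq : ∀ t A, MeasurableSet[F t] A → Q A = ∫⁻ ω in A, ENNReal.ofReal (Z t ω) ∂P

namespace IsDensityFamily

variable {Q P : Measure Omega} {Z : ℝ≥0 → Omega → ℝ}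

lemma measurable (h : IsDensityFamily Q P Z) (t : ℝ≥0) : Measurable (Z t) :=
  (h.adapted t).mono (F.le t) le_rfl

lemma nonneg (h : IsDensityFamily Q P Z) (t : ℝ≥0) : 0 ≤ᵐ[P] Z t := by
  filter_upwards [h.pos t] with ω hω using hω.le

lemma integrable [IsProbabilityMeasure Q] (h : IsDensityFamily Q P Z) (t : ℝ≥0) :
    Integrable (Z t) P := by
  refine ⟨(h.measurable t).aestronglyMeasurable, ?_⟩
  rw [hasFiniteIntegral_iff_ofReal (h.nonneg t), ← setLIntegral_univ,
    ← h.apply_eq t univ MeasurableSet.univ]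
  exact measure_lt_top Q _

lemma eq_setIntegral (h : IsDensityFamily Q P Z) : IsDensityProcess Q P Z := by
  intro s t hst A hA
  rw [Measure.real, h.apply_eq t A (F.mono hst A hA),
    integral_eq_lintegral_of_nonneg_ae (ae_restrict_of_ae (h.nonneg t))
      (h.measurable t).aestronglyMeasurable]

lemma martingale [IsProbabilityMeasure Q] [IsProbabilityMeasure P] (h : IsDensityFamily Q P Z) :
    Martingale Z F P := by
  refine ⟨fun t => (h.adapted t).stronglyMeasurable, fun s t hst => ?_⟩
  refine (ae_eq_condExp_of_forall_setIntegral_eq (F.le s) (h.integrable t)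
    (fun A _ _ => (h.integrable s).integrableOn) (fun A hA _ => ?_)
    (h.adapted s).stronglyMeasurable.aestronglyMeasurable).symm
  rw [← h.eq_setIntegral s s le_rfl A hA, ← h.eq_setIntegral s t hst A hA]

/-- Strict positivity is what allows a vanishing integral over `A` to force `P A = 0`. -/
lemma progEquiv (h : IsDensityFamily Q P Z) : ProgEquiv Q P := by
  intro t A hA
  have hA' := F.le t A hA
  rw [h.apply_eq t A hA, lintegral_eq_zero_iff (h.measurable t).ennreal_ofReal]
  constructor
  · intro h0
    rw [← Measure.restrict_eq_zero, ← ae_eq_bot, ← Filter.eventually_false_iff_eq_bot]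
    filter_upwards [h0, ae_restrict_of_ae (h.pos t)] with ω h1 h2
    exact absurd (ENNReal.ofReal_eq_zero.1 h1) (not_le.2 h2)
  · intro h0
    rw [Measure.restrict_eq_zero.2 h0, ae_zero]
    exact eventually_bot

end IsDensityFamily

lemma isDensityFamily_cpp {β : Pos → Pos → ℝ} {α γ : Pos → ℝ}
    (hβ : ∀ x θ, β x θ = α θ + γ x) (hα : Measurable α) (hγ : Measurable γ) {r θ : Pos}
    (hr : (r : ℝ) = θ * Real.exp (α θ)) {μ ν : Measure Pos} [IsProbabilityMeasure μ]
    [IsProbabilityMeasure ν] (hν : ν = μ.withDensity fun x => ENNReal.ofReal (Real.exp (γ x))) :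
    IsDensityFamily (cpp r ν θ) (cpp θ μ θ) (MTilde β α θ) where
  adapted t := measurable_MTilde_F hβ hα hγ t measurable_const
  pos _ := ae_of_all _ fun _ => Real.exp_pos _
  apply_eq t _ hA := cpp_apply_eq_lintegral hβ hγ hr hν t hA

/-! ### Mixtures -/

/-- The family of compound Poisson laws with rates `g θ` as a kernel. -/
def cppKernel (g : Pos → Pos) (hg : Measurable g) (ν : Measure Pos) [IsProbabilityMeasure ν] :
    Kernel Pos Omega :=
  (((fibre ν).comap g hg).map Prod.fst) ×ₖ Kernel.deterministic id measurable_id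

/-- The fibre at `g θ` carries the wrong last coordinate `g θ`; the kernel discards it and attaches
`θ` instead, so measurability is inherited from `fibre`. -/
lemma cppKernel_apply (g : Pos → Pos) (hg : Measurable g) (ν : Measure Pos)
    [IsProbabilityMeasure ν] (θ : Pos) : cppKernel g hg ν θ = cpp (g θ) ν θ := by
  have : IsMarkovKernel (((fibre ν).comap g hg).map Prod.fst) :=
    Kernel.IsMarkovKernel.map _ measurable_fst
  rw [cppKernel, Kernel.prod_apply, Kernel.deterministic_apply, Kernel.map_apply _ measurable_fst,
    Kernel.comap_apply, fibre_eq_cpp, map_fst_cpp]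
  rfl

instance (g : Pos → Pos) (hg : Measurable g) (ν : Measure Pos) [IsProbabilityMeasure ν] :
    IsMarkovKernel (cppKernel g hg ν) :=
  ⟨fun θ => by rw [cppKernel_apply]; infer_instance⟩

section Bind

variable {κ : Kernel Pos Omega} {π : Measure Pos}

lemma bind_inter_preimage_Θ (hΘ : ∀ θ, ∀ᵐ ω ∂(κ θ), Θ ω = θ) {B : Set Pos} (hB : MeasurableSet B)
    {D : Set Omega} (hD : MeasurableSet D) :
    π.bind κ (Θ ⁻¹' B ∩ D) = ∫⁻ θ in B, κ θ D ∂π := by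
  rw [Measure.bind_apply ((measurable_Θ hB).inter hD) κ.aemeasurable, ← lintegral_indicator hB]
  refine lintegral_congr fun θ => ?_
  by_cases hθ : θ ∈ B
  · rw [indicator_of_mem hθ]
    refine measure_congr ?_
    filter_upwards [hΘ θ] with ω hω
    refine propext ⟨fun h => h.2, fun h => ⟨?_, h⟩⟩
    exact mem_preimage.2 (hω ▸ hθ)
  · rw [indicator_of_notMem hθ]
    refine measure_mono_null inter_subset_left ?_
    refine measure_eq_zero_iff_ae_notMem.2 ?_
    filter_upwards [hΘ θ] with ω hω h
    exact hθ (hω ▸ h)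

variable [IsMarkovKernel κ]

lemma map_Θ_bind (hΘ : ∀ θ, ∀ᵐ ω ∂(κ θ), Θ ω = θ) : (π.bind κ).map Θ = π := by
  ext B hB
  have := bind_inter_preimage_Θ (π := π) hΘ hB MeasurableSet.univ
  rw [Measure.map_apply measurable_Θ hB]
  simpa using this

lemma disintegrates_bind [IsProbabilityMeasure π] (hΘ : ∀ θ, ∀ᵐ ω ∂(κ θ), Θ ω = θ) :
    Disintegrates κ (π.bind κ) := by
  rw [disintegrates_iff]
  intro B hB D hD
  rw [map_Θ_bind hΘ, bind_inter_preimage_Θ hΘ hB hD]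

end Bind

lemma ae_Θ_cppKernel (g : Pos → Pos) (hg : Measurable g) (ν : Measure Pos)
    [IsProbabilityMeasure ν] (θ : Pos) : ∀ᵐ ω ∂(cppKernel g hg ν θ), Θ ω = θ := by
  rw [cppKernel_apply]
  exact ae_Θ_cpp _ _ _

section Initial

variable (μ ρ : Measure Pos) [IsProbabilityMeasure μ]

lemma map_Θ_initial : (initial μ ρ).map Θ = ρ := map_Θ_bind fun θ => ae_Θ_cpp θ μ θ

lemma disintegrates_initial [IsProbabilityMeasure ρ] : Disintegrates (fibre μ) (initial μ ρ) :=
  disintegrates_bind fun θ => ae_Θ_cpp θ μ θ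

lemma Disintegrates.map_X_zero {κ : Kernel Pos Omega} [IsMarkovKernel κ] {Q : Measure Omega}
    [IsProbabilityMeasure Q] {g : Pos → Pos} {ν : Measure Pos} [IsProbabilityMeasure ν]
    (h : Disintegrates κ Q) (hκ : ∀ θ, κ θ = cpp (g θ) ν θ) : Q.map (X 0) = ν := by
  have h1 : X 0 = (fun x : ℕ → Pos => x 0) ∘ fun ω : Omega => ω.1.2 := rfl
  rw [h1, ← Measure.map_map (by fun_prop) (by fun_prop), h.map_X hκ]
  exact Measure.infinitePi_map_eval (fun _ : ℕ => ν) 0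

lemma map_X_zero_initial [IsProbabilityMeasure ρ] : (initial μ ρ).map (X 0) = μ :=
  (disintegrates_initial μ ρ).map_X_zero (g := id) fun _ => rfl

end Initial

/-- The density of one mixture of compound Poisson laws with respect to another on `F t`. -/
lemma isDensityFamily_mixture {β : Pos → Pos → ℝ} {α γ ξ : Pos → ℝ}
    (hβ : ∀ x θ, β x θ = α θ + γ x) (hα : Measurable α) (hγ : Measurable γ) (hξ : Measurable ξ)
    {g : Pos → Pos} (hg : ∀ θ, (g θ : ℝ) = θ * Real.exp (α θ))
    {μ ν ρ : Measure Pos} [IsProbabilityMeasure μ] [IsProbabilityMeasure ν]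
    [IsProbabilityMeasure ρ] (hν : ν = μ.withDensity fun x => ENNReal.ofReal (Real.exp (γ x)))
    (hξpos : ∀ᵐ θ ∂ρ, 0 < ξ θ)
    {κ : Kernel Pos Omega} [IsMarkovKernel κ] {Q : Measure Omega} [IsProbabilityMeasure Q]
    (hQ : Disintegrates κ Q) (hκ : ∀ θ, κ θ = cpp (g θ) ν θ)
    (hQΘ : Q.map Θ = ρ.withDensity fun θ => ENNReal.ofReal (ξ θ)) :
    IsDensityFamily Q (initial μ ρ) (MProc β α ξ) := by
  have hadapted : ∀ t, Measurable[F t] (MProc β α ξ t) := fun t =>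
    (hξ.comp (measurable_Θ_F t)).mul (measurable_MTilde_F hβ hα hγ t (measurable_Θ_F t))
  refine ⟨hadapted, fun t => ?_, fun t A hA => ?_⟩
  · have h : ∀ᵐ ω ∂(initial μ ρ), 0 < ξ (Θ ω) := by
      refine ae_of_ae_map (f := Θ) (p := fun θ => 0 < ξ θ) measurable_Θ.aemeasurable ?_
      rwa [map_Θ_initial]
    filter_upwards [h] with ω hω
    exact mul_pos hω (Real.exp_pos _)
  · have hA' := F.le t A hA
    have hm : Measurable fun ω => ENNReal.ofReal (MProc β α ξ t ω) :=
      ((hadapted t).mono (F.le t) le_rfl).ennreal_ofReal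
    rw [← hQ.apply hA', lintegral_of_eq_withDensity hξ.ennreal_ofReal hQΘ (κ.measurable_coe hA'),
      ← lintegral_indicator hA', initial,
      Measure.lintegral_bind (fibre μ).aemeasurable (hm.indicator hA').aemeasurable]
    -- Both sides are now integrals over `ρ`, and the claim is the fibrewise density formula
    -- multiplied by `ξ θ`.
    refine lintegral_congr fun θ => ?_
    rw [hκ, cpp_apply_eq_lintegral hβ hγ (hg θ) hν t hA, fibre_eq_cpp,
      ← lintegral_const_mul _ (measurable_MTilde hβ hγ θ t).ennreal_ofReal,
      lintegral_indicator hA']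
    refine lintegral_congr_ae (ae_restrict_of_ae ?_)
    filter_upwards [ae_Θ_cpp θ μ θ] with ω hω
    rw [MProc, hω, MTilde, ENNReal.ofReal_mul' (Real.exp_pos _).le]

/-! ### The path of the counting process determines the interarrival times -/

/-- The `n`-th arrival time as a function of the path of the counting process. -/
def hitting (n : ℕ) (p : ℝ≥0 → ℕ) : ℝ≥0∞ :=
  ⨅ q : ℚ, if n ≤ p (q : ℝ).toNNReal then ((q : ℝ).toNNReal : ℝ≥0∞) else ⊤

lemma measurable_hitting (n : ℕ) : Measurable (hitting n) := by
  refine Measurable.iInf fun q => Measurable.ite ?_ measurable_const measurable_const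
  exact measurableSet_le measurable_const (measurable_pi_apply (X := fun _ : ℝ≥0 => ℕ) _)

/-- The times with at least `n` arrivals form a half-line starting at the `n`-th arrival, so
rational times suffice for the infimum; negative rationals merely repeat time zero. -/
lemma hitting_count {w : ℕ → Pos} (hw : w ∈ nonExplosive) (n : ℕ) :
    hitting n (fun t => count t w) = ENNReal.ofReal (arrival n w) := by
  refine le_antisymm (le_of_forall_gt fun c hc => ?_) (le_iInf fun q => ?_)
  · obtain ⟨q, -, hq1, hq2⟩ := ENNReal.lt_iff_exists_rat_btwn.1 hc
    refine lt_of_le_of_lt (iInf_le _ q) ?_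
    rw [if_pos]
    · exact hq2
    · rw [le_count_iff hw]
      have h := ENNReal.coe_lt_coe.1 hq1
      exact (Real.toNNReal_le_iff_le_coe).1 h.le
  · split_ifs with h
    · rw [le_count_iff hw] at h
      exact ENNReal.coe_le_coe.2 (Real.toNNReal_le_iff_le_coe.2 h)
    · exact le_top

/-- The interarrival times as a function of the path of the counting process. -/
def interarrival (p : ℝ≥0 → ℕ) (n : ℕ) : Pos :=
  posOf ((hitting (n + 1) p).toReal - (hitting n p).toReal)

lemma measurable_interarrival : Measurable interarrival :=
  measurable_pi_lambda _ fun n => measurable_posOf.comp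
    ((measurable_hitting (n + 1)).ennreal_toReal.sub (measurable_hitting n).ennreal_toReal)

lemma interarrival_count {w : ℕ → Pos} (hw : w ∈ nonExplosive) :
    interarrival (fun t => count t w) = w := by
  ext1 n
  have h : arrival (n + 1) w = arrival n w + w n := Finset.sum_range_succ _ _
  rw [interarrival, hitting_count hw, hitting_count hw, ENNReal.toReal_ofReal (arrival_nonneg _ _),
    ENNReal.toReal_ofReal (arrival_nonneg _ _), h, add_sub_cancel_left, posOf_coe]

/-- The law of the interarrival times is determined by the law of the counting process. -/
lemma map_W_eq_of_map_path_eq {m₁ m₂ : Measure Omega} (h₁ : ∀ᵐ ω ∂m₁, ω.1.1 ∈ nonExplosive)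
    (h₂ : ∀ᵐ ω ∂m₂, ω.1.1 ∈ nonExplosive)
    (h : m₁.map (fun ω t => N t ω) = m₂.map fun ω t => N t ω) :
    m₁.map (fun ω => ω.1.1) = m₂.map fun ω => ω.1.1 := by
  have key : ∀ m : Measure Omega, (∀ᵐ ω ∂m, ω.1.1 ∈ nonExplosive) →
      m.map (fun ω => ω.1.1) = (m.map fun ω t => N t ω).map interarrival := by
    intro m hm
    rw [Measure.map_map measurable_interarrival measurable_path_N]
    refine Measure.map_congr ?_
    filter_upwards [hm] with ω hω
    exact (interarrival_count hω).symm
  rw [key m₁ h₁, key m₂ h₂, h]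

/-! ### The increments determine the law of the counting process -/

lemma natCast_N_eq_sum_incr {n : ℕ} {t : Fin (n + 1) → ℝ≥0} (h0 : t 0 = 0) (ω : Omega)
    (i : Fin (n + 1)) : (N (t i) ω : ℤ) = ∑ j : Fin n with j.castSucc < i, incr t 0 ω j := by
  induction i using Fin.induction with
  | zero => simp [h0, N_zero]
  | succ i ih =>
    have hset : ({j : Fin n | j.castSucc < i.succ} : Finset (Fin n))
        = insert i ({j : Fin n | j.castSucc < i.castSucc} : Finset (Fin n)) := by
      ext j
      simp only [Finset.mem_filter, Finset.mem_univ, true_and, Finset.mem_insert,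
        Fin.lt_def, Fin.val_castSucc, Fin.val_succ, Fin.ext_iff]
      omega
    rw [hset, Finset.sum_insert (by simp), ← ih, incr, zero_add, zero_add]
    ring

/-- A law on path space is determined by its finite-dimensional marginals, and these are images of
increment laws. Finite measures are allowed because the lemma is applied to restrictions to events
of `Θ`. -/
lemma map_path_eq_of_map_incr_eq {m₁ m₂ : Measure Omega} [IsFiniteMeasure m₁] [IsFiniteMeasure m₂]
    (h : ∀ (n : ℕ) (t : Fin (n + 1) → ℝ≥0), Monotone t →
      m₁.map (incr t 0) = m₂.map (incr t 0)) :
    m₁.map (fun ω t => N t ω) = m₂.map fun ω t => N t ω := by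
  classical
  have h1 := isProjectiveLimit_map (P := m₁) (X := N) measurable_path_N.aemeasurable
  have h2 := isProjectiveLimit_map (P := m₂) (X := N) measurable_path_N.aemeasurable
  have h3 : (fun I : Finset ℝ≥0 => m₁.map fun ω => I.restrict (N · ω))
      = fun I : Finset ℝ≥0 => m₂.map fun ω => I.restrict (N · ω) := by
    ext1 I
    -- With time `0` in the grid, where `N` vanishes, counts are partial sums of increments.
    set J := insert 0 I with hJ
    obtain ⟨n, hn⟩ : ∃ n, J.card = n + 1 :=
      Nat.exists_eq_succ_of_ne_zero (Finset.card_ne_zero_of_mem (Finset.mem_insert_self 0 I))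
    set e := J.orderIsoOfFin hn
    set t : Fin (n + 1) → ℝ≥0 := fun i => e i with ht
    have htm : Monotone t := fun i j hij => (e.monotone hij)
    have ht0 : t 0 = 0 := by
      refine le_antisymm ?_ zero_le
      have h0 : (⟨0, Finset.mem_insert_self 0 I⟩ : J) = e (e.symm ⟨0, Finset.mem_insert_self 0 I⟩) :=
        (e.apply_symm_apply _).symm
      calc t 0 ≤ t (e.symm ⟨0, Finset.mem_insert_self 0 I⟩) := htm (Fin.zero_le _)
        _ = 0 := by simp [ht]
    let ψ : (Fin n → ℤ) → (I → ℕ) := fun k s =>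
      (∑ j : Fin n with j.castSucc < e.symm ⟨s, Finset.mem_insert_of_mem s.2⟩, k j).toNat
    have hψ : ∀ ω, I.restrict (N · ω) = ψ (incr t 0 ω) := by
      intro ω
      ext s
      have := natCast_N_eq_sum_incr ht0 ω (e.symm ⟨s, Finset.mem_insert_of_mem s.2⟩)
      simp only [ψ, ← this, Int.toNat_natCast]
      simp [ht]
    have key : ∀ m : Measure Omega, m.map (fun ω => I.restrict (N · ω))
        = (m.map (incr t 0)).map ψ := by
      intro m
      rw [Measure.map_map (measurable_of_countable ψ) (measurable_incr t 0)]
      congr 1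
      ext1 ω
      exact hψ ω
    rw [key, key, h n t htm]
  rw [h3] at h1
  exact h1.unique h2

/-! ### The increments of a mixed Poisson process given the structure parameter -/

section

variable {κ : Kernel Pos Omega} [IsMarkovKernel κ] {Q : Measure Omega} [IsProbabilityMeasure Q]
  {g : Pos → Pos}

lemma poissonMeasure_zero_mul (r : Pos) :
    poissonMeasure ((0 : ℝ≥0) * (r : ℝ).toNNReal) = Measure.dirac 0 := by
  rw [← map_count_iid r 0]
  have : count 0 = fun _ => 0 := funext count_zero
  rw [this, Measure.map_const, measure_univ, one_smul]

lemma IsMixedPoissonProcess.ae_map_N (hQ : IsMixedPoissonProcess Q g) (h : Disintegrates κ Q)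
    (t : ℝ≥0) :
    ∀ᵐ θ ∂(Q.map Θ), (κ θ).map (N t) = poissonMeasure (t * (g θ : ℝ).toNNReal) := by
  rcases eq_or_ne t 0 with rfl | ht
  · refine ae_of_all _ fun θ => ?_
    have : N 0 = fun _ => 0 := funext N_zero
    rw [poissonMeasure_zero_mul, this, Measure.map_const, measure_univ, one_smul]
  · filter_upwards [hQ.poisson t (pos_iff_ne_zero.2 ht), h.condDistrib_ae_eq (measurable_N t)]
      with θ h1 h2
    rw [← h2, h1]

/-- Stationarity, for the two-point grid `0, t - s` shifted by `s`, reduces the increment to a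
count. -/
lemma IsMixedPoissonProcess.ae_map_sub_N (hQ : IsMixedPoissonProcess Q g)
    (h : Disintegrates κ Q) {s t : ℝ≥0} (hst : s ≤ t) :
    ∀ᵐ θ ∂(Q.map Θ), (κ θ).map (fun ω => (N t ω : ℤ) - N s ω) = incrLaw (g θ) (t - s) := by
  have hm : Monotone ![0, t - s] := by
    intro i j hij
    fin_cases i <;> fin_cases j <;> simp_all
  have hms : ∀ r : ℝ≥0, Measurable (incr ![0, t - s] r) := measurable_incr _
  have hcomp : ∀ r : ℝ≥0, (fun ω => (N (r + (t - s)) ω : ℤ) - N r ω)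
      = (fun k : Fin 1 → ℤ => k 0) ∘ incr ![0, t - s] r := by
    intro r
    ext ω
    simp [incr]
  filter_upwards [hQ.stationary 1 _ hm s, h.condDistrib_ae_eq (hms s), h.condDistrib_ae_eq (hms 0),
    hQ.ae_map_N h (t - s)] with θ h1 h2 h3 h4
  have h5 := hcomp s
  have h6 := hcomp 0
  rw [add_tsub_cancel_of_le hst] at h5
  rw [zero_add] at h6
  rw [h5, ← Measure.map_map (measurable_pi_apply 0) (hms s), ← h2, h1, h3,
    Measure.map_map (measurable_pi_apply 0) (hms 0), ← h6, incrLaw, ← h4,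
    Measure.map_map (measurable_of_countable _) (measurable_N _)]
  congr 1
  ext ω
  simp [N_zero]

/-- Increment vectors take countably many values, so the a.e. product formulas for single points
hold simultaneously for almost every `θ`. -/
lemma IsMixedPoissonProcess.ae_map_incr (hQ : IsMixedPoissonProcess Q g) (h : Disintegrates κ Q)
    {n : ℕ} {t : Fin (n + 1) → ℝ≥0} (ht : Monotone t) :
    ∀ᵐ θ ∂(Q.map Θ), (κ θ).map (incr t 0)
      = Measure.pi fun i => incrLaw (g θ) (t i.succ - t i.castSucc) := by
  have hmi : ∀ i, Measurable fun ω => incr t 0 ω i := fun i =>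
    (measurable_pi_apply i).comp (measurable_incr t 0)
  have h1 : ∀ k : Fin n → ℤ, ∀ᵐ θ ∂(Q.map Θ), κ θ (⋂ i ∈ Finset.univ, (incr t 0 · i) ⁻¹' {k i})
      = ∏ i, κ θ ((incr t 0 · i) ⁻¹' {k i}) := by
    intro k
    have hind := Kernel.iIndepFun.congr h.condExpKernel_ae_eq (hQ.indep n t ht)
    have h2 := hind.measure_inter_preimage_eq_mul _ _ Finset.univ (sets := fun i => {k i})
      fun i _ => measurableSet_singleton _
    refine (ae_map_iff_ae_trim measurable_Θ ?_).2 h2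
    refine measurableSet_eq_fun (κ.measurable_coe ?_)
      (Finset.measurable_fun_prod _ fun i _ => κ.measurable_coe ?_)
    · exact Finset.measurableSet_biInter _ fun i _ => hmi i (measurableSet_singleton _)
    · exact hmi i (measurableSet_singleton _)
  have h2 : ∀ i : Fin n, ∀ᵐ θ ∂(Q.map Θ), (κ θ).map (fun ω => incr t 0 ω i)
      = incrLaw (g θ) (t i.succ - t i.castSucc) := by
    intro i
    filter_upwards [hQ.ae_map_sub_N h (ht (Fin.castSucc_le_succ i))] with θ hθ
    rw [← hθ]
    congr 1
    ext ω
    simp [incr]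
  filter_upwards [ae_all_iff.2 h1, ae_all_iff.2 h2] with θ h1 h2
  refine Measure.ext_of_singleton fun k => ?_
  rw [Measure.map_apply (measurable_incr t 0) (measurableSet_singleton k), Measure.pi_singleton]
  have hset : incr t 0 ⁻¹' {k} = ⋂ i ∈ Finset.univ, (incr t 0 · i) ⁻¹' {k i} := by
    ext ω
    simp [funext_iff]
  rw [hset, h1 k]
  refine Finset.prod_congr rfl fun i _ => ?_
  rw [← h2 i, Measure.map_apply (hmi i) (measurableSet_singleton _)]

/-- The joint law of the structure parameter and the increments of a mixed Poisson process. -/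
lemma IsMixedPoissonProcess.map_restrict_incr (hQ : IsMixedPoissonProcess Q g) {n : ℕ}
    {t : Fin (n + 1) → ℝ≥0} (ht : Monotone t) {B : Set Pos} (hB : MeasurableSet B)
    (E : Set (Fin n → ℤ)) :
    (Q.restrict (Θ ⁻¹' B)).map (incr t 0) E
      = ∫⁻ θ in B, Measure.pi (fun i => incrLaw (g θ) (t i.succ - t i.castSucc)) E
        ∂(Q.map Θ) := by
  have hE : MeasurableSet E := E.to_countable.measurableSet
  have hE' := measurable_incr t 0 hE
  have h := disintegrates_condDistrib (Q := Q)
  rw [Measure.map_apply (measurable_incr t 0) hE, Measure.restrict_apply hE', inter_comm,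
    ← disintegrates_iff.1 h B hB _ hE']
  refine lintegral_congr_ae (ae_restrict_of_ae ?_)
  filter_upwards [hQ.ae_map_incr h ht] with θ hθ
  rw [← hθ, Measure.map_apply (measurable_incr t 0) hE]

end

/-! ### The claim sizes are independent of the remaining variables -/

lemma IsRiskProcess.map_X {Q : Measure Omega} [IsProbabilityMeasure Q] (h : IsRiskProcess Q) :
    have : IsProbabilityMeasure (Q.map (X 0)) :=
      Measure.isProbabilityMeasure_map (measurable_X 0).aemeasurable
    Q.map (fun ω => ω.1.2) = iid (Q.map (X 0)) := by
  have h1 := h.indep.map_fun_eq_infinitePi_map measurable_X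
  simp_rw [h.identDistrib] at h1
  exact h1

/-- By (a1) the fibre probability of the rectangle is a product, and by (a2) its claim factor is
almost surely the unconditional probability; integration over `B` leaves the law of the interarrival
times restricted to `Θ` in `B`. -/
lemma measure_rectangle {Q : Measure Omega} [IsProbabilityMeasure Q] (h1 : CondA1 Q)
    (h2 : CondA2 Q) {A C : Set (ℕ → Pos)} {B : Set Pos} (hA : MeasurableSet A)
    (hC : MeasurableSet C) (hB : MeasurableSet B) :
    Q ((A ×ˢ C) ×ˢ B) = (Q.restrict (Θ ⁻¹' B)).map (fun ω => ω.1.1) A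
      * Q.map (fun ω => ω.1.2) C := by
  have hmW : Measurable fun ω : Omega => ω.1.1 := by fun_prop
  have hmX : Measurable fun ω : Omega => ω.1.2 := by fun_prop
  set κ := condDistrib id Θ Q with hκ
  have h := disintegrates_condDistrib (Q := Q)
  have hAm := hmW hA
  have hCm := hmX hC
  have hind : ∀ᵐ θ ∂(Q.map Θ), κ θ ((fun ω : Omega => ω.1.1) ⁻¹' A ∩ (fun ω => ω.1.2) ⁻¹' C)
      = κ θ ((fun ω : Omega => ω.1.1) ⁻¹' A) * κ θ ((fun ω : Omega => ω.1.2) ⁻¹' C) := by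
    have h3 := (Kernel.IndepFun.congr h.condExpKernel_ae_eq h1).measure_inter_preimage_eq_mul
      A C hA hC
    refine (ae_map_iff_ae_trim measurable_Θ ?_).2 h3
    exact measurableSet_eq_fun (κ.measurable_coe (hAm.inter hCm))
      ((κ.measurable_coe hAm).mul (κ.measurable_coe hCm))
  have hX : ∀ᵐ θ ∂(Q.map Θ), κ θ ((fun ω : Omega => ω.1.2) ⁻¹' C)
      = Q.map (fun ω => ω.1.2) C := by
    refine ae_eq_of_forall_setLIntegral_eq_of_sigmaFinite (κ.measurable_coe hCm)
      measurable_const fun B' hB' _ => ?_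
    rw [disintegrates_iff.1 h B' hB' _ hCm, setLIntegral_const, mul_comm,
      Measure.map_apply measurable_Θ hB', Measure.map_apply hmX hC]
    exact h2.measure_inter_preimage_eq_mul _ _ hB' hC
  have hset : (A ×ˢ C) ×ˢ B
      = Θ ⁻¹' B ∩ ((fun ω : Omega => ω.1.1) ⁻¹' A ∩ (fun ω => ω.1.2) ⁻¹' C) := by
    ext ω
    simp only [mem_prod, mem_inter_iff, mem_preimage]
    exact and_comm
  rw [hset, ← disintegrates_iff.1 h B hB _ (hAm.inter hCm), Measure.map_apply hmW hA,
    Measure.restrict_apply hAm, inter_comm _ (Θ ⁻¹' B), ← disintegrates_iff.1 h B hB _ hAm,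
    ← lintegral_mul_const _ (κ.measurable_coe hAm)]
  refine lintegral_congr_ae (ae_restrict_of_ae ?_)
  filter_upwards [hind, hX] with θ h3 h4
  rw [h3, h4]

/-- A probability measure with (a1) and (a2) under which `S` is a compound mixed Poisson process is
determined by the laws of the structure parameter and of the claim sizes. -/
theorem eq_of_isCMPP {Q₁ Q₂ : Measure Omega} [IsProbabilityMeasure Q₁] [IsProbabilityMeasure Q₂]
    {g : Pos → Pos} (a1 : CondA1 Q₁) (a2 : CondA2 Q₁) (c : IsCMPP Q₁ g) (a1' : CondA1 Q₂)
    (a2' : CondA2 Q₂) (c' : IsCMPP Q₂ g) (hΘ : Q₁.map Θ = Q₂.map Θ)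
    (hX : Q₁.map (X 0) = Q₂.map (X 0)) : Q₁ = Q₂ := by
  refine Measure.ext_prod₃' fun {A C B} hA hC hB => ?_
  rw [measure_rectangle a1 a2 hA hC hB, measure_rectangle a1' a2' hA hC hB, c.1.map_X, c'.1.map_X]
  simp_rw [hX]
  congr 2
  refine map_W_eq_of_map_path_eq (ae_restrict_of_ae ((isCountingProcess_iff _).1 c.1.counting))
    (ae_restrict_of_ae ((isCountingProcess_iff _).1 c'.1.counting)) ?_
  refine map_path_eq_of_map_incr_eq fun n t ht => ?_
  ext E -
  rw [c.2.map_restrict_incr ht hB, c'.2.map_restrict_incr ht hB, hΘ]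

/-! ### Consequences of progressive equivalence -/

lemma measurableSet_claim_event {B : Set Pos} (hB : MeasurableSet B) :
    MeasurableSet[F 1] {ω | ∑ k ∈ Finset.range (N 1 ω), B.indicator 1 (X k ω) ≠ (0 : ℝ)} :=
  (measurable_sum_X_F (measurable_one.indicator hB) 1 (measurableSet_singleton 0)).compl

/-- The probability that a claim with size in `B` occurs up to time one. -/
lemma cpp_claim_event_eq_zero_iff (r : Pos) (ν : Measure Pos) [IsProbabilityMeasure ν] (θ : Pos)
    {B : Set Pos} (hB : MeasurableSet B) :
    cpp r ν θ {ω | ∑ k ∈ Finset.range (N 1 ω), B.indicator 1 (X k ω) ≠ (0 : ℝ)} = 0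
      ↔ ν B = 0 := by
  have hX : ∀ k, cpp r ν θ (X k ⁻¹' B) = ν B := by
    intro k
    have h1 : X k = (fun x : ℕ → Pos => x k) ∘ fun ω : Omega => ω.1.2 := rfl
    rw [← Measure.map_apply (measurable_X k) hB, h1,
      ← Measure.map_map (by fun_prop) (by fun_prop), map_X_cpp]
    exact congrArg (· B) (Measure.infinitePi_map_eval (fun _ : ℕ => ν) k)
  constructor
  · intro h
    have hind : IndepFun (N 1) (X 0) (cpp r ν θ) :=
      (indepFun_W_X_cpp r ν θ).comp (measurable_count 1) (measurable_pi_apply 0)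
    have h1 : cpp r ν θ (N 1 ⁻¹' {1} ∩ X 0 ⁻¹' B) = 0 := by
      refine measure_mono_null (fun ω hω => ?_) h
      have hN : N 1 ω = 1 := hω.1
      have hX0 : X 0 ω ∈ B := hω.2
      simp [hN, hX0]
    rw [hind.measure_inter_preimage_eq_mul _ _ (measurableSet_singleton 1) hB, hX,
      ← Measure.map_apply (measurable_N 1) (measurableSet_singleton 1),
      (isPoissonProcess_cpp r ν θ).poisson 1 one_pos, mul_eq_zero] at h1
    refine h1.resolve_left ?_
    rw [poissonMeasure_singleton]
    have : 0 < ((1 * (r : ℝ).toNNReal : ℝ≥0) : ℝ) := by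
      rw [one_mul, Real.coe_toNNReal _ r.2.le]
      exact r.2
    exact (ENNReal.ofReal_pos.2 (by positivity)).ne'
  · intro h
    refine measure_mono_null (fun ω hω => ?_)
      (measure_iUnion_null fun k => (hX k).trans h)
    obtain ⟨k, -, hk⟩ := Finset.exists_ne_zero_of_sum_ne_zero hω
    have hk' : X k ω ∈ B := mem_of_indicator_ne_zero hk
    exact mem_iUnion.2 ⟨k, hk'⟩

lemma Disintegrates.claim_event_eq_zero_iff {κ : Kernel Pos Omega} [IsMarkovKernel κ]
    {Q : Measure Omega} [IsProbabilityMeasure Q] {g : Pos → Pos} {ν : Measure Pos}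
    [IsProbabilityMeasure ν] (h : Disintegrates κ Q) (hκ : ∀ θ, κ θ = cpp (g θ) ν θ)
    {B : Set Pos} (hB : MeasurableSet B) :
    Q {ω | ∑ k ∈ Finset.range (N 1 ω), B.indicator 1 (X k ω) ≠ (0 : ℝ)} = 0 ↔ ν B = 0 := by
  have hm := F.le 1 _ (measurableSet_claim_event hB)
  rw [← h.apply hm, lintegral_eq_zero_iff (κ.measurable_coe hm)]
  constructor
  · intro h0
    obtain ⟨θ, hθ⟩ := h0.exists
    have hθ' : κ θ _ = 0 := hθ
    rw [hκ] at hθ'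
    exact (cpp_claim_event_eq_zero_iff (g θ) ν θ hB).1 hθ'
  · intro h0
    refine ae_of_all _ fun θ => ?_
    change κ θ _ = 0
    rw [hκ]
    exact (cpp_claim_event_eq_zero_iff (g θ) ν θ hB).2 h0

lemma ProgEquiv.map_Θ_eq_zero_iff {Q P : Measure Omega} (h : ProgEquiv Q P) {B : Set Pos}
    (hB : MeasurableSet B) : Q.map Θ B = 0 ↔ P.map Θ B = 0 := by
  rw [Measure.map_apply measurable_Θ hB, Measure.map_apply measurable_Θ hB]
  exact h 0 _ (measurable_Θ_F 0 hB)

/-- The explicit mixture over `Q.map Θ` satisfies the same conditions with the same laws of `Θ` and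
of the claims, so by `eq_of_isCMPP` it is `Q` itself. -/
lemma disintegrates_of_isCMPP {Q : Measure Omega} [IsProbabilityMeasure Q] {g : Pos → Pos}
    (hg : Measurable g) {ν : Measure Pos} [IsProbabilityMeasure ν] (a1 : CondA1 Q)
    (a2 : CondA2 Q) (c : IsCMPP Q g) (hX : Q.map (X 0) = ν) :
    Disintegrates (cppKernel g hg ν) Q := by
  have hκ := cppKernel_apply g hg ν
  have hd : Disintegrates (cppKernel g hg ν) ((Q.map Θ).bind (cppKernel g hg ν)) :=
    disintegrates_bind (ae_Θ_cppKernel g hg ν)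
  have hQ : Q = (Q.map Θ).bind (cppKernel g hg ν) :=
    eq_of_isCMPP a1 a2 c (hd.condA1 hκ) (hd.condA2 hκ) (hd.isCMPP hκ)
      (map_Θ_bind (ae_Θ_cppKernel g hg ν)).symm (by rw [hX, hd.map_X_zero hκ])
  rw [hQ]
  exact hd

/-! ### Radon-Nikodym derivatives -/

lemma exists_pos_isRNDeriv {ν μ : Measure Pos} [IsProbabilityMeasure ν] [IsProbabilityMeasure μ]
    (h : ∀ B, MeasurableSet B → (ν B = 0 ↔ μ B = 0)) :
    ∃ f : Pos → ℝ, IsRNDeriv f ν μ ∧ ∀ᵐ x ∂μ, 0 < f x := by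
  have h1 : ν ≪ μ := Measure.AbsolutelyContinuous.mk fun B hB h0 => (h B hB).2 h0
  have h2 : μ ≪ ν := Measure.AbsolutelyContinuous.mk fun B hB h0 => (h B hB).1 h0
  refine ⟨fun x => (ν.rnDeriv μ x).toReal, ⟨(Measure.measurable_rnDeriv ν μ).ennreal_toReal,
    ae_of_all _ fun x => ENNReal.toReal_nonneg, ?_⟩, ?_⟩
  · conv_lhs => rw [← Measure.withDensity_rnDeriv_eq ν μ h1]
    refine withDensity_congr_ae ?_
    filter_upwards [Measure.rnDeriv_lt_top ν μ] with x hx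
    rw [ENNReal.ofReal_toReal hx.ne]
  · filter_upwards [Measure.rnDeriv_lt_top ν μ, Measure.rnDeriv_pos' h2] with x hx hx'
    exact ENNReal.toReal_pos hx'.ne' hx.ne

lemma IsRNDeriv.integral_eq_one {f : Pos → ℝ} {ν μ : Measure Pos} [IsProbabilityMeasure ν]
    (h : IsRNDeriv f ν μ) : ∫ x, f x ∂μ = 1 := by
  rw [integral_eq_lintegral_of_nonneg_ae h.2.1 h.1.aestronglyMeasurable, ← setLIntegral_univ,
    ← withDensity_apply _ MeasurableSet.univ, ← h.2.2, measure_univ, ENNReal.toReal_one]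

lemma IsRNDeriv.ae_eq {f f' : Pos → ℝ} {ν μ : Measure Pos} [IsProbabilityMeasure μ]
    (h : IsRNDeriv f ν μ) (h' : IsRNDeriv f' ν μ) : ∀ᵐ x ∂μ, f' x = f x := by
  have h1 := (withDensity_eq_iff_of_sigmaFinite h'.1.ennreal_ofReal.aemeasurable
    h.1.ennreal_ofReal.aemeasurable).1 (h'.2.2.symm.trans h.2.2)
  filter_upwards [h1, h.2.1, h'.2.1] with x hx h0 h0'
  exact (ENNReal.ofReal_eq_ofReal_iff h0' h0).1 hx

lemma isProbabilityMeasure_withDensity_ofReal {f : Pos → ℝ} {μ : Measure Pos}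
    (h0 : ∀ᵐ x ∂μ, 0 ≤ f x) (h1 : ∫ x, f x ∂μ = 1) :
    IsProbabilityMeasure (μ.withDensity fun x => ENNReal.ofReal (f x)) := by
  refine ⟨?_⟩
  have hint : Integrable f μ := by
    by_contra hc
    rw [integral_undef hc] at h1
    exact zero_ne_one h1
  rw [withDensity_apply _ MeasurableSet.univ, setLIntegral_univ,
    ← ofReal_integral_eq_lintegral_ofReal hint h0, h1, ENNReal.ofReal_one]

lemma RPlus_iff {P : Measure Omega} {ξ : Pos → ℝ} :
    ξ ∈ RPlus P ↔ Measurable ξ ∧ (∀ᵐ θ ∂(P.map Θ), 0 < ξ θ) ∧ ∫ θ, ξ θ ∂(P.map Θ) = 1 := by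
  refine and_congr_right fun h => and_congr_right fun _ => ?_
  rw [integral_map measurable_Θ.aemeasurable h.aestronglyMeasurable]

lemma MProc_zero (β : Pos → Pos → ℝ) (α ξ : Pos → ℝ) (ω : Omega) :
    MProc β α ξ 0 ω = ξ (Θ ω) := by
  simp [MProc, MTilde, N_zero]

/-- The density process at time zero is a density of the structure distribution. -/
lemma IsDensityProcess.isRNDeriv {Q P : Measure Omega} [IsProbabilityMeasure Q]
    {β : Pos → Pos → ℝ} {α ξ : Pos → ℝ} (h : IsDensityProcess Q P (MProc β α ξ))
    (hξ : ξ ∈ RPlus P) : IsRNDeriv ξ (Q.map Θ) (P.map Θ) := by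
  obtain ⟨hm, hpos, h1⟩ := RPlus_iff.1 hξ
  have h0 : ∀ᵐ θ ∂(P.map Θ), 0 ≤ ξ θ := by filter_upwards [hpos] with θ hθ using hθ.le
  have hint : Integrable ξ (P.map Θ) := by
    by_contra hc
    rw [integral_undef hc] at h1
    exact zero_ne_one h1
  refine ⟨hm, h0, ?_⟩
  ext B hB
  have h2 := h 0 0 le_rfl _ (measurable_Θ_F 0 hB)
  simp_rw [MProc_zero] at h2
  rw [withDensity_apply _ hB, ← ofReal_integral_eq_lintegral_ofReal hint.integrableOn
    (ae_restrict_of_ae h0), setIntegral_map hB hm.aestronglyMeasurable measurable_Θ.aemeasurable,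
    ← h2, Measure.map_apply measurable_Θ hB, ofReal_measureReal]

/-! ### The correspondence -/

/-- Two splittings differ by a constant moved between the summands, and the normalization of `exp γ`
forces it to vanish. -/
lemma IsSplit.unique {P : Measure Omega} [IsProbabilityMeasure P] {β : Pos → Pos → ℝ}
    {α γ α' γ' : Pos → ℝ} (h : IsSplit P β α γ) (h' : IsSplit P β α' γ') : α' = α ∧ γ' = γ := by
  obtain ⟨c, hc⟩ : ∃ c, ∀ x, γ' x = γ x + c := by
    refine ⟨α ⟨1, mem_Ioi.2 one_pos⟩ - α' ⟨1, mem_Ioi.2 one_pos⟩, fun x => ?_⟩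
    linarith [h.eq_add x ⟨1, mem_Ioi.2 one_pos⟩, h'.eq_add x ⟨1, mem_Ioi.2 one_pos⟩]
  have h1 := h'.integral_exp
  simp_rw [hc, Real.exp_add] at h1
  rw [integral_mul_const, h.integral_exp, one_mul, Real.exp_eq_one_iff] at h1
  subst h1
  simp only [add_zero] at hc
  refine ⟨funext fun θ => ?_, funext hc⟩
  linarith [h.eq_add θ θ, h'.eq_add θ θ, hc θ]

lemma Corresponds.coe_g {P Q : Measure Omega} {g : Pos → Pos} {β : Pos → Pos → ℝ}
    {ξ α γ : Pos → ℝ} (h : Corresponds P g Q β ξ α γ) (θ : Pos) :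
    (g θ : ℝ) = θ * Real.exp (α θ) :=
  h.g_eq ((fun _ => θ, fun _ => θ), θ)

lemma Corresponds.map_X_zero {P Q : Measure Omega} {g : Pos → Pos}
    {β : Pos → Pos → ℝ} {ξ α γ : Pos → ℝ} (h : Corresponds P g Q β ξ α γ) :
    Q.map (X 0) = (P.map (X 0)).withDensity fun x => ENNReal.ofReal (Real.exp (γ x)) := by
  obtain ⟨f, hf, hfγ⟩ := h.γ_eq
  rw [hf.2.2]
  refine withDensity_congr_ae ?_
  filter_upwards [hfγ] with x hx
  rw [hx.2, Real.exp_log hx.1]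

section

variable {μ ρ : Measure Pos} [IsProbabilityMeasure μ] [IsProbabilityMeasure ρ]

instance (Q : Measure Omega) [IsProbabilityMeasure Q] : IsProbabilityMeasure (Q.map (X 0)) :=
  Measure.isProbabilityMeasure_map (measurable_X 0).aemeasurable

/-- The common core of (i) and (ii): once `Q` is a mixture of compound Poisson laws with matching
parameters, the density family delivers the rest. -/
lemma corresponds_of_disintegrates {κ : Kernel Pos Omega} [IsMarkovKernel κ] {Q : Measure Omega}
    [IsProbabilityMeasure Q] {g : Pos → Pos} {ν : Measure Pos} [IsProbabilityMeasure ν]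
    (h : Disintegrates κ Q) (hκ : ∀ θ, κ θ = cpp (g θ) ν θ) {β : Pos → Pos → ℝ} {ξ α γ f : Pos → ℝ}
    (hs : IsSplit (initial μ ρ) β α γ) (hg : ∀ θ, (g θ : ℝ) = θ * Real.exp (α θ))
    (hf : IsRNDeriv f ν μ) (hfγ : ∀ᵐ x ∂μ, 0 < f x ∧ γ x = Real.log (f x))
    (hξ : IsRNDeriv ξ (Q.map Θ) ρ) (hξpos : ∀ᵐ θ ∂ρ, 0 < ξ θ) :
    Corresponds (initial μ ρ) g Q β ξ α γ ∧ ProgEquiv Q (initial μ ρ) := by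
  have hν : ν = μ.withDensity fun x => ENNReal.ofReal (Real.exp (γ x)) := by
    rw [hf.2.2]
    refine withDensity_congr_ae ?_
    filter_upwards [hfγ] with x hx
    rw [hx.2, Real.exp_log hx.1]
  have hd := isDensityFamily_mixture hs.eq_add hs.measurable_α hs.measurable_γ hξ.1 hg hν hξpos h
    hκ hξ.2.2
  refine ⟨⟨hs, fun ω => hg _, ⟨f, ?_, ?_⟩, hd.eq_setIntegral, hd.martingale⟩, hd.progEquiv⟩
  · rwa [h.map_X_zero hκ, map_X_zero_initial]
  · rwa [map_X_zero_initial]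

lemma measurable_uncurry_add {α γ : Pos → ℝ} (hα : Measurable α) (hγ : Measurable γ) :
    Measurable (Function.uncurry fun x θ : Pos => α θ + γ x) :=
  (hα.comp measurable_snd).add (hγ.comp measurable_fst)

theorem exists_corresponds {g : Pos → Pos} {Q : Measure Omega} [IsProbabilityMeasure Q]
    (hg : Measurable g) (hQ : MemM (initial μ ρ) g Q) :
    ∃ β ∈ FP (initial μ ρ), ∃ ξ ∈ RPlus (initial μ ρ),
      IsRNDeriv ξ (Q.map Θ) ((initial μ ρ).map Θ) ∧
        ∃ α γ, Corresponds (initial μ ρ) g Q β ξ α γ := by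
  have hd := disintegrates_of_isCMPP hg hQ.a1 hQ.a2 hQ.cmpp rfl
  have hκ := cppKernel_apply g hg (Q.map (X 0))
  -- Equivalence of the claim laws is tested on the event that some claim up to time one lies in
  -- `B`: it belongs to `F 1` and is null exactly when `B` is null for the claim law.
  obtain ⟨f, hf, hfpos⟩ := exists_pos_isRNDeriv (ν := Q.map (X 0)) (μ := μ) fun B hB => by
    rw [← hd.claim_event_eq_zero_iff hκ hB,
      ← (disintegrates_initial μ ρ).claim_event_eq_zero_iff (g := id) (fun _ => rfl) hB]
    exact hQ.progEquiv 1 _ (measurableSet_claim_event hB)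
  obtain ⟨ξ, hξ, hξpos⟩ := exists_pos_isRNDeriv (ν := Q.map Θ) (μ := ρ) fun B hB => by
    rw [hQ.progEquiv.map_Θ_eq_zero_iff hB, map_Θ_initial]
  let α : Pos → ℝ := fun θ => Real.log (g θ / θ)
  let γ : Pos → ℝ := fun x => Real.log (f x)
  have hα : Measurable α := Real.measurable_log.comp
    ((measurable_subtype_coe.comp hg).div measurable_subtype_coe)
  have hγ : Measurable γ := Real.measurable_log.comp hf.1
  have hs : IsSplit (initial μ ρ) (fun x θ => α θ + γ x) α γ := by
    refine ⟨hα, hγ, fun _ _ => rfl, ?_⟩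
    rw [← integral_map (f := fun x => Real.exp (γ x)) (measurable_X 0).aemeasurable
      (Real.measurable_exp.comp hγ).aestronglyMeasurable, map_X_zero_initial, ← hf.integral_eq_one]
    refine integral_congr_ae ?_
    filter_upwards [hfpos] with x hx
    exact Real.exp_log hx
  have hgα : ∀ θ, (g θ : ℝ) = θ * Real.exp (α θ) := by
    intro θ
    have hθ : (0 : ℝ) < θ := θ.2
    rw [Real.exp_log (div_pos (g θ).2 hθ), mul_div_cancel₀ _ hθ.ne']
  refine ⟨_, ⟨measurable_uncurry_add hα hγ, α, γ, hs⟩, ξ, RPlus_iff.2 ?_, ?_, α, γ,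
    (corresponds_of_disintegrates hd hκ hs hgα hf ?_ hξ hξpos).1⟩
  · rw [map_Θ_initial]
    exact ⟨hξ.1, hξpos, hξ.integral_eq_one⟩
  · rwa [map_Θ_initial]
  · filter_upwards [hfpos] with x hx using ⟨hx, rfl⟩

/-- `g` fixes `α` everywhere, the claim law fixes `γ` almost everywhere, and the density process at
time zero is `ξ`. -/
theorem Corresponds.ae_eq {P Q : Measure Omega} [IsProbabilityMeasure P] [IsProbabilityMeasure Q]
    {g : Pos → Pos} {β β' : Pos → Pos → ℝ} {ξ ξ' α γ α' γ' : Pos → ℝ}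
    (h : Corresponds P g Q β ξ α γ) (h' : Corresponds P g Q β' ξ' α' γ') (hξ : ξ ∈ RPlus P)
    (hξ' : ξ' ∈ RPlus P) :
    (∀ᵐ p ∂((P.map (X 0)).prod (P.map Θ)), β' p.1 p.2 = β p.1 p.2) ∧
      ∀ᵐ θ ∂(P.map Θ), ξ' θ = ξ θ := by
  refine ⟨?_, (h.density.isRNDeriv hξ).ae_eq (h'.density.isRNDeriv hξ')⟩
  have hα : ∀ θ, α' θ = α θ := fun θ => by
    have hθ : (0 : ℝ) < θ := θ.2
    exact Real.exp_injective (mul_left_cancel₀ hθ.ne' ((h'.coe_g θ).symm.trans (h.coe_g θ)))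
  obtain ⟨f, hf, hfγ⟩ := h.γ_eq
  obtain ⟨f', hf', hfγ'⟩ := h'.γ_eq
  have hγ : ∀ᵐ x ∂(P.map (X 0)), γ' x = γ x := by
    filter_upwards [hf.ae_eq hf', hfγ, hfγ'] with x h1 h2 h3
    rw [h3.2, h2.2, h1]
  filter_upwards [Measure.quasiMeasurePreserving_fst.ae hγ] with p hp
  rw [h'.split.eq_add, h.split.eq_add, hα, hp]

theorem exists_memM_corresponds {β : Pos → Pos → ℝ} {ξ α γ : Pos → ℝ}
    (hs : IsSplit (initial μ ρ) β α γ) (hξ : ξ ∈ RPlus (initial μ ρ)) :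
    ∃ (g : Pos → Pos) (Q : ProbabilityMeasure Omega), Measurable g ∧
      MemM (initial μ ρ) g Q ∧
      IsRNDeriv ξ ((Q : Measure Omega).map Θ) ((initial μ ρ).map Θ) ∧
      Corresponds (initial μ ρ) g Q β ξ α γ := by
  obtain ⟨hξm, hξpos, hξ1⟩ := RPlus_iff.1 hξ
  rw [map_Θ_initial] at hξpos hξ1
  have hξ0 : ∀ᵐ θ ∂ρ, 0 ≤ ξ θ := by filter_upwards [hξpos] with θ hθ using hθ.le
  have hγ := hs.integral_exp
  rw [← integral_map (f := fun x => Real.exp (γ x)) (measurable_X 0).aemeasurable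
    (Real.measurable_exp.comp hs.measurable_γ).aestronglyMeasurable, map_X_zero_initial] at hγ
  let g : Pos → Pos := fun θ => ⟨θ * Real.exp (α θ), mem_Ioi.2 (mul_pos θ.2 (Real.exp_pos _))⟩
  have hg : Measurable g := by
    refine Measurable.subtype_mk ?_
    exact measurable_subtype_coe.mul (Real.measurable_exp.comp hs.measurable_α)
  set ν := μ.withDensity fun x => ENNReal.ofReal (Real.exp (γ x)) with hν
  set π := ρ.withDensity fun θ => ENNReal.ofReal (ξ θ) with hπ
  have : IsProbabilityMeasure ν :=
    isProbabilityMeasure_withDensity_ofReal (ae_of_all _ fun x => (Real.exp_pos _).le) hγ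
  have : IsProbabilityMeasure π := isProbabilityMeasure_withDensity_ofReal hξ0 hξ1
  have hκ := cppKernel_apply g hg ν
  have hd : Disintegrates (cppKernel g hg ν) (π.bind (cppKernel g hg ν)) :=
    disintegrates_bind (ae_Θ_cppKernel g hg ν)
  have hΘ : (π.bind (cppKernel g hg ν)).map Θ = π := map_Θ_bind (ae_Θ_cppKernel g hg ν)
  have hprob : IsProbabilityMeasure (π.bind (cppKernel g hg ν)) := inferInstance
  obtain ⟨Q, hQ⟩ : ∃ Q : ProbabilityMeasure Omega,
      (Q : Measure Omega) = π.bind (cppKernel g hg ν) := ⟨⟨_, hprob⟩, rfl⟩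
  rw [← hQ] at hd hΘ
  have hrn : IsRNDeriv ξ ((Q : Measure Omega).map Θ) ρ := ⟨hξm, hξ0, hΘ⟩
  obtain ⟨hc, hp⟩ := corresponds_of_disintegrates hd hκ hs (fun θ => rfl)
    (f := fun x => Real.exp (γ x))
    ⟨Real.measurable_exp.comp hs.measurable_γ, ae_of_all _ fun x => (Real.exp_pos _).le, hν⟩
    (ae_of_all _ fun x => ⟨Real.exp_pos _, (Real.log_exp _).symm⟩) hrn hξpos
  refine ⟨g, Q, hg, ⟨hd.condA1 hκ, hd.condA2 hκ, hp, hd.isCMPP hκ⟩, ?_, hc⟩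
  rw [map_Θ_initial]
  exact hrn

theorem Corresponds.unique {P Q Q' : Measure Omega} [IsProbabilityMeasure P]
    [IsProbabilityMeasure Q] [IsProbabilityMeasure Q'] {g g' : Pos → Pos} {β : Pos → Pos → ℝ}
    {ξ α γ α' γ' : Pos → ℝ} (h : Corresponds P g Q β ξ α γ) (h' : Corresponds P g' Q' β ξ α' γ')
    (hξ : ξ ∈ RPlus P) (hQ : MemM P g Q) (hQ' : MemM P g' Q') : g' = g ∧ Q' = Q := by
  obtain ⟨rfl, rfl⟩ := h.split.unique h'.split
  have hg : g' = g := funext fun θ => Subtype.ext ((h'.coe_g θ).trans (h.coe_g θ).symm)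
  subst hg
  refine ⟨rfl, eq_of_isCMPP hQ'.a1 hQ'.a2 hQ'.cmpp hQ.a1 hQ.a2 hQ.cmpp ?_ ?_⟩
  · exact (h'.density.isRNDeriv hξ).2.2.trans (h.density.isRNDeriv hξ).2.2.symm
  · rw [h'.map_X_zero, h.map_X_zero]

/-- The canonical kernel serves as the conditional probability, and its fibres are compound Poisson
laws for every `θ`, not just almost every one. -/
theorem Corresponds.exists_isRCP {g : Pos → Pos} {Q : Measure Omega} [IsProbabilityMeasure Q]
    (hg : Measurable g) (hQ : MemM (initial μ ρ) g Q) {β : Pos → Pos → ℝ} {ξ α γ : Pos → ℝ}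
    (h : Corresponds (initial μ ρ) g Q β ξ α γ) :
    ∃ κ : Kernel Pos Omega, IsRCP κ Q ∧
      (∀ κ', IsRCP κ' Q → ∀ᵐ θ ∂((initial μ ρ).map Θ), κ' θ = κ θ) ∧
      ∀ θ, MemMFibre (fibre μ θ) g θ (κ θ) ∧
        IsDensityProcess (κ θ) (fibre μ θ) (MTilde β α θ) ∧
        Martingale (MTilde β α θ) F (fibre μ θ) := by
  have hd := disintegrates_of_isCMPP hg hQ.a1 hQ.a2 hQ.cmpp rfl
  -- Uniqueness of disintegrations holds off a null set of `Q.map Θ`; this transfers it to the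
  -- structure law under `initial μ ρ`.
  have hac : (initial μ ρ).map Θ ≪ Q.map Θ := Measure.AbsolutelyContinuous.mk fun B hB h0 =>
    (hQ.progEquiv.map_Θ_eq_zero_iff hB).1 h0
  have hν := h.map_X_zero
  rw [map_X_zero_initial] at hν
  refine ⟨cppKernel g hg (Q.map (X 0)), hd.isRCP (ae_Θ_cppKernel g hg _), fun κ' hκ' => ?_,
    fun θ => ?_⟩
  · have := hκ'.isMarkovKernel
    exact hac.ae_le (hκ'.disintegrates.ae_eq hd)
  · have hf := isDensityFamily_cpp h.split.eq_add h.split.measurable_α h.split.measurable_γ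
      (h.coe_g θ) hν
    rw [cppKernel_apply, fibre_eq_cpp]
    exact ⟨⟨hf.progEquiv, isCPP_cpp _ _ _⟩, hf.eq_setIntegral, hf.martingale⟩

end

end CMPP

end

open CMPP
theorem theorem4p3 (μ ρ : Measure Pos)
    [IsProbabilityMeasure μ] [IsProbabilityMeasure ρ]
    (P : Measure Omega) (hP : P = initial μ ρ) :
    -- (i) from `(g, Q)` to `(β, ξ)`
    (∀ (g : Pos → Pos) (Q : ProbabilityMeasure Omega),
      Measurable g → MemM P g Q →
      ∃ β ∈ FP P, ∃ ξ ∈ RPlus P,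
        IsRNDeriv ξ ((Q : Measure Omega).map Θ) (P.map Θ) ∧
        (∃ α γ, Corresponds P g Q β ξ α γ) ∧
        ∀ β' ∈ FP P, ∀ ξ' ∈ RPlus P,
          (∃ α' γ', Corresponds P g Q β' ξ' α' γ') →
          (∀ᵐ p ∂((P.map (X 0)).prod (P.map Θ)), β' p.1 p.2 = β p.1 p.2) ∧
          ∀ᵐ θ ∂(P.map Θ), ξ' θ = ξ θ) ∧
    -- (ii) from `(β, ξ)` to `(g, Q)`
    (∀ β ∈ FP P, ∀ ξ ∈ RPlus P,
      ∃ (g : Pos → Pos) (Q : ProbabilityMeasure Omega),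
        (Measurable g ∧ MemM P g Q ∧
          IsRNDeriv ξ ((Q : Measure Omega).map Θ) (P.map Θ) ∧
          ∃ α γ, Corresponds P g Q β ξ α γ) ∧
        ∀ (g' : Pos → Pos) (Q' : ProbabilityMeasure Omega),
          Measurable g' → MemM P g' Q' →
          (∃ α γ, Corresponds P g' Q' β ξ α γ) → g' = g ∧ Q' = Q) ∧
    -- (iii) the fibrewise description, for all associated `(g, Q)` and `(β, ξ)`
    (∀ (g : Pos → Pos) (Q : ProbabilityMeasure Omega),
      Measurable g → MemM P g Q →
      ∀ β ∈ FP P, ∀ ξ ∈ RPlus P, ∀ α γ, Corresponds P g Q β ξ α γ →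
      ∃ κ : Kernel Pos Omega,
        IsRCP κ Q ∧
        (∀ κ', IsRCP κ' Q → ∀ᵐ θ ∂(P.map Θ), κ' θ = κ θ) ∧
        ∃ V : Set Pos, MeasurableSet V ∧ P.map Θ V = 0 ∧
          ∀ θ, θ ∉ V →
            MemMFibre (fibre μ θ) g θ (κ θ) ∧
            IsDensityProcess (κ θ) (fibre μ θ) (MTilde β α θ) ∧
            Martingale (MTilde β α θ) F (fibre μ θ)) := by
  subst hP
  refine ⟨fun g Q hg hQ => ?_, fun β hβ ξ hξ => ?_, fun g Q hg hQ β _ ξ _ α γ h => ?_⟩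
  · obtain ⟨β, hβ, ξ, hξ, hrn, α, γ, h⟩ := exists_corresponds hg hQ
    exact ⟨β, hβ, ξ, hξ, hrn, ⟨α, γ, h⟩, fun β' _ ξ' hξ' ⟨α', γ', h'⟩ => h.ae_eq h' hξ hξ'⟩
  · obtain ⟨-, α, γ, hs⟩ := hβ
    obtain ⟨g, Q, hg, hQ, hrn, h⟩ := exists_memM_corresponds hs hξ
    refine ⟨g, Q, ⟨hg, hQ, hrn, α, γ, h⟩, fun g' Q' _ hQ' ⟨α', γ', h'⟩ => ?_⟩
    obtain ⟨h1, h2⟩ := h.unique h' hξ hQ hQ'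
    exact ⟨h1, Subtype.ext h2⟩
  · obtain ⟨κ, h1, h2, h3⟩ := h.exists_isRCP hg hQ
    -- The exceptional set can be empty because this version of the kernel has no bad fibres.
    exact ⟨κ, h1, h2, ∅, MeasurableSet.empty, measure_empty, fun θ _ => h3 θ⟩
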